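/- **Theorem (Training error).** Let $M,T\ge 1$, $N_1,\dots,N_T\ge 1$, and let $\mathbb Y,\mathbb X\subseteq\mathbb R^M$ be sets all of whose elements have entries bounded by $B_d$ in absolute value. Let $\mathrm D$ be a probability distribution of pairs (noisy image, clean image), concentrated on $\mathbb Y\times\mathbb X$. For $t=1,\dots,T$ let $\lambda_t>0$ and let $R_t:\mathbb R^M\to(-\infty,+\infty]$ be proper, closed and convex (in particular, $R_t$ may be any such function that has subgradients). For a weight $w\in(0,\infty)^M$ put $$f_t^{w}(\mathcal Y):=\arg\min_{\mathcal X\in\mathbb R^M}\ \tfrac12\|w\odot(\mathcal Y-\mathcal X)\|_2^2+\lambda_tR_t(\mathcal X),\qquad f_t^{h}(\mathcal Y):=f_t^{h(\mathcal Y)}(\mathcal Y)\ \text{ for a weight function } h:\mathbb R^M\to\mathbb R^M .$$ Let $\mathcal H=\{h_\theta:\theta\in\Theta\}$, $\Theta\subseteq\mathbb R^p$, where each $h_\theta:\mathbb R^M\to\mathbb R^M$ is measurable, $\theta\mapsto h_\theta(\mathcal Y)$ is continuous on $\Theta$ for each $\mathcal Y\in\mathbb Y$, and $0<\varepsilon\le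 h_\theta(\mathcal Y)_m\le B_H$ for all $\theta\in\Theta$, $\mathcal Y\in\mathbb Y$, $m\le M$. Let $\mathbb Z\subseteq\mathbb R^M$ be a set (for example $\mathbb R^M$) that contains all restored images $f_t^w(\mathcal Y)$ with $t\le T$, $\mathcal Y\in\mathbb Y$, $w\in[\varepsilon,B_H]^M$, and let $\ell:\mathbb R^M\times\mathbb R^M\to\mathbb R$ be a measurable loss such that $|\ell|\le B_l$ on $\mathbb Z\times\mathbb X$ and $\ell(\cdot,\mathcal X)$ is $L_n$-Lipschitz on $\mathbb Z$ for the Euclidean norm, for each $\mathcal X\in\mathbb X$. Let $\mathbf S=\{(\mathcal Y_{ti},\mathcal X_{ti})\}_{t\le T,\,i\le N_t}$ be i.i.d. from $\mathrm D$, and define the empirical risk, the expected risk and the empirical Gaussian complexity by $$\hat{\mathbf R}_{tr}(h)=\frac1T\sum_{t=1}^T\frac1{N_t}\sum_{i=1}^{N_t}\ell\big(f_t^h(\mathcal Y_{ti}),\mathcal X_{ti}\big),\qquad \mathbf R_{tr}(h)=\frac1T\sum_{t=1}^T\mathbb E_{(\mathcal Y,\mathcal X)\sim\mathrm D}\,\ell\big(f_t^h(\mathcal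 Y),\mathcal X\big),$$ $$\hat{\mathfrak G}_{\mathbf S}(\mathcal H)=\mathbb E_g\Big[\sup_{h\in\mathcal H}\frac1T\sum_{t=1}^T\frac1{N_t}\sum_{i=1}^{N_t}\sum_{m=1}^M g_{tim}\,h(\mathcal Y_{ti})_m\Big],\qquad g_{tim}\ \text{i.i.d. } \mathcal N(0,1).$$ Let $\hat h_{tr}$ be a minimizer of $\hat{\mathbf R}_{tr}$ over $\mathcal H$ (for each sample) and $h^*_{tr}$ a minimizer of $\mathbf R_{tr}$ over $\mathcal H$. Then: 1. For all $t$, $\mathcal Y\in\mathbb R^M$ and $w\in[\varepsilon,B_H]^M$ the minimization problem that defines $f_t^w(\mathcal Y)$ has exactly one solution. 2. There is a least constant $L_H\ge0$ such that $\|f_t^{w_1}(\mathcal Y)-f_t^{w_2}(\mathcal Y)\|_2\le L_H\|w_1-w_2\|_2$ for all $t\le T$, $\mathcal Y\in\mathbb Y$ and $w_1,w_2\in[\varepsilon,B_H]^M$. If moreover all elements of $\mathbb Z$ have entries bounded by $B_d$ in absolute value, then $L_H\le 4B_dB_H/\varepsilon^2$. 3. With this $L_H$, for every $\delta>0$, with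 probability at least $1-\delta$ over $\mathbf S$, $$\mathbf R_{tr}(\hat h_{tr})-\mathbf R_{tr}(h^*_{tr})\ \le\ 6L_nL_H\,\hat{\mathfrak G}_{\mathbf S}(\mathcal H)+\frac{6B_l}{T}\sqrt{\sum_{t=1}^T\frac1{N_t}}\ \sqrt{\frac{\log(2/\delta)}{2}} .$$ -/

import Mathlib

open MeasureTheory ProbabilityTheory
open scoped NNReal

noncomputable section

namespace HWnet

/-- Images (tensors of size `M`), flattened, with the Euclidean norm. -/
abbrev Img (M : ℕ) : Type := EuclideanSpace ℝ (Fin M)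

/-- Proper, closed (lower semicontinuous) and convex extended-real-valued functions. -/
structure IsProperClosedConvex {M : ℕ} (R : Img M → EReal) : Prop where
  ne_bot : ∀ X, R X ≠ ⊥
  exists_ne_top : ∃ X, R X ≠ ⊤
  closed : LowerSemicontinuous R
  convex : Convex ℝ {p : Img M × ℝ | R p.1 ≤ (p.2 : EReal)}

/-- The weighted denoising objective `X ↦ ½ ‖W ⊙ (Y - X)‖² + lam * R X`. -/
def objective {M : ℕ} (lam : ℝ) (R : Img M → EReal) (W Y X : Img M) : EReal :=
  (((1 / 2 : ℝ) * ∑ m, (W m * (Y m - X m)) ^ 2 : ℝ) : EReal) + (lam : EReal) * R X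

/-- `X` minimizes the weighted denoising objective over all images. -/
def IsDenoised {M : ℕ} (lam : ℝ) (R : Img M → EReal) (W Y X : Img M) : Prop :=
  ∀ X', objective lam R W Y X ≤ objective lam R W Y X'

/-- The denoising model: `argmin_X ½ ‖W ⊙ (Y - X)‖² + lam * R X`. -/
def denoise {M : ℕ} (lam : ℝ) (R : Img M → EReal) (W Y : Img M) : Img M :=
  Classical.epsilon (IsDenoised lam R W Y)

/-- The weights all of whose entries lie in `[ε, B]`. -/
def weightBox (M : ℕ) (ε B : ℝ) : Set (Img M) :=
  {W | ∀ m, ε ≤ W m ∧ W m ≤ B}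

/-- The constants `L ≥ 0` such that all `T` solution maps `W ↦ denoise (lam t) (R t) W Y`,
`Y ∈ 𝕐`, are `L`-Lipschitz on the box of admissible weights. -/
def lipConstants {M T : ℕ} (lam : Fin T → ℝ) (R : Fin T → Img M → EReal) (𝕐 : Set (Img M))
    (ε B : ℝ) : Set ℝ :=
  {L | 0 ≤ L ∧ ∀ t, ∀ Y ∈ 𝕐, ∀ W₁ ∈ weightBox M ε B, ∀ W₂ ∈ weightBox M ε B,
    ‖denoise (lam t) (R t) W₁ Y - denoise (lam t) (R t) W₂ Y‖ ≤ L * ‖W₁ - W₂‖}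

/-- The Lipschitz constant of the solution maps with respect to the weight. -/
def lipConst {M T : ℕ} (lam : Fin T → ℝ) (R : Fin T → Img M → EReal) (𝕐 : Set (Img M))
    (ε B : ℝ) : ℝ :=
  sInf (lipConstants lam R 𝕐 ε B)

/-- The index `(t, i)` of a training pair: the `i`-th pair of the `t`-th source model. -/
abbrev PairIdx {T : ℕ} (N : Fin T → ℕ) : Type := Σ t : Fin T, Fin (N t)

/-- A training sample: the pairs `(Y, X)` of a noisy and a clean image. -/
abbrev Sample (M : ℕ) {T : ℕ} (N : Fin T → ℕ) : Type := PairIdx N → Img M × Img M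

/-- The law of an i.i.d. sample from `D`. -/
def sampleLaw {M T : ℕ} (N : Fin T → ℕ) (D : Measure (Img M × Img M)) : Measure (Sample M N) :=
  Measure.pi fun _ => D

/-- The empirical (training) risk of the weight function `h` on the sample `S`. -/
def empRisk {M T : ℕ} (N : Fin T → ℕ) (lam : Fin T → ℝ) (R : Fin T → Img M → EReal)
    (loss : Img M → Img M → ℝ) (S : Sample M N) (h : Img M → Img M) : ℝ :=
  (1 / (T : ℝ)) * ∑ t, (1 / (N t : ℝ)) * ∑ i : Fin (N t),
    loss (denoise (lam t) (R t) (h (S ⟨t, i⟩).1) (S ⟨t, i⟩).1) (S ⟨t, i⟩).2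

/-- The expected risk of the weight function `h` over the `T` source models. -/
def expRisk {M T : ℕ} (D : Measure (Img M × Img M)) (lam : Fin T → ℝ)
    (R : Fin T → Img M → EReal) (loss : Img M → Img M → ℝ) (h : Img M → Img M) : ℝ :=
  (1 / (T : ℝ)) * ∑ t, ∫ z, loss (denoise (lam t) (R t) (h z.1) z.1) z.2 ∂D

/-- The empirical Gaussian complexity of `{h θ | θ ∈ Θ}` on the noisy images of `S`. -/
def gaussComplexity {M T p : ℕ} (N : Fin T → ℕ) (Θ : Set (EuclideanSpace ℝ (Fin p)))
    (h : EuclideanSpace ℝ (Fin p) → Img M → Img M) (S : Sample M N) : ℝ :=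
  ∫ g : PairIdx N × Fin M → ℝ,
    (⨆ θ : Θ, (1 / (T : ℝ)) * ∑ t, (1 / (N t : ℝ)) * ∑ i : Fin (N t), ∑ m,
      g (⟨t, i⟩, m) * h θ (S ⟨t, i⟩).1 m)
    ∂(Measure.pi fun _ => gaussianReal 0 1)

end HWnet

end

/-!
The restored image is the minimizer of a strongly convex function. Monotonicity of the
subdifferential of the regularizer gives one stability estimate, `IsDenoised.norm_sub_le`: it
bounds the distance of two minimizers by the change of the gradient of the data term at one of
them. Uniqueness, joint continuity (hence measurability) and the Lipschitz bound in the weight all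
follow from it; existence follows since a proper closed convex function decreases at most linearly.

For the training error put `L = Ln * lipConst`. As `θhat` minimizes the empirical risk, the excess
risk is at most `sup_θ (R(θ) - R̂(θ)) + (R̂(θstar) - R(θstar))`. The bound then rests on the
following facts.

* McDiarmid's inequality is applied once, to this quantity minus twice the empirical Rademacher
  average of the weighted losses. If the `k`-th loss is bounded by `bₖ`, the first two terms have
  differences at most `2 bₖ` each. The Rademacher average only has differences `bₖ`, because the
  average over the sign of the changed loss lies between `sup A` and `sup A + bₖ`, with `A` the sum
  of the other terms (`radAvg_sub_radAvg_le`). The total `6 bₖ` is the source of the constant `6`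
  in the deviation term (`measure_iSup_deviation_le`).
* By symmetrization the mean of that function is at most zero (`integral_iSup_deviation_le`).
* A Rademacher average is at most three times a Gaussian average of vector-valued functions with
  dominating increments (`radAvg_le_gaussian`). The signs are replaced one by one, using
  `‖u‖ ≤ 3 𝔼 |⟨g, u⟩|` for a standard Gaussian `g` (`sqrt_sum_sq_le_integral_abs`). The weighted
  losses are dominated by the weighted networks times `L`, and `2 * 3 = 6` is the constant in front
  of the Gaussian complexity.

The parameter set may be uncountable and the solution map is only controlled for admissible
weights. Continuity in the parameter reduces the suprema to a countable dense set, and the losses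
are replaced by versions that are measurable everywhere and agree with them almost surely
(`truncLoss`).
-/

/-! ### McDiarmid's inequality -/

namespace HWnet

variable {𝓩 : Type*} [MeasurableSpace 𝓩]

lemma integrable_of_measurable_of_abs_le {Ω : Type*} [MeasurableSpace Ω] {μ : Measure Ω}
    [IsFiniteMeasure μ] {f : Ω → ℝ} (hf : Measurable f) {K : ℝ} (hK : ∀ x, |f x| ≤ K) :
    Integrable f μ :=
  Integrable.of_bound hf.aestronglyMeasurable K (Filter.Eventually.of_forall hK)

lemma abs_integral_le_of_abs_le {Ω : Type*} [MeasurableSpace Ω] {μ : Measure Ω}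
    [IsProbabilityMeasure μ] {f : Ω → ℝ} {K : ℝ} (hK : ∀ x, |f x| ≤ K) :
    |∫ x, f x ∂μ| ≤ K := by
  have h := norm_integral_le_of_norm_le_const (μ := μ) (f := f) (C := K)
    (Filter.Eventually.of_forall fun x => by simpa using hK x)
  simpa using h

lemma integral_pi_fin_succ {α : Type*} [MeasurableSpace α] (μ : Measure α)
    [IsProbabilityMeasure μ] {n : ℕ} {G : (Fin (n + 1) → α) → ℝ}
    (hG : Integrable G (Measure.pi fun _ => μ)) :
    ∫ S, G S ∂(Measure.pi fun _ => μ)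
      = ∫ x, ∫ y, G (Fin.cons x y) ∂(Measure.pi fun _ : Fin n => μ) ∂μ := by
  have hmp := (measurePreserving_piFinSuccAbove (fun _ : Fin (n + 1) => μ) 0).symm
  have hG' := (hmp.integrable_comp_emb (MeasurableEquiv.measurableEmbedding _)).2 hG
  rw [← hmp.integral_comp (MeasurableEquiv.measurableEmbedding _)]
  refine (integral_prod _ hG').trans ?_
  simp [MeasurableEquiv.piFinSuccAbove, Fin.insertNthEquiv]

/-- Hoeffding's lemma for a random variable whose oscillation is at most `c`. -/
lemma mgf_sub_integral_le_of_oscillation_le {μ : Measure 𝓩} [IsProbabilityMeasure μ] {f : 𝓩 → ℝ}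
    (hf : Measurable f) {c : ℝ} (hc : ∀ x y, f x - f y ≤ c) (s : ℝ) :
    ∫ x, Real.exp (s * (f x - ∫ y, f y ∂μ)) ∂μ ≤ Real.exp (c ^ 2 / 4 * s ^ 2 / 2) := by
  have : Nonempty 𝓩 := nonempty_of_isProbabilityMeasure μ
  have hbdd : BddBelow (Set.range f) := by
    obtain ⟨x₀⟩ := this
    exact ⟨f x₀ - c, by rintro _ ⟨y, rfl⟩; linarith [hc x₀ y]⟩
  have hmem : ∀ x, f x ∈ Set.Icc (⨅ y, f y) ((⨅ y, f y) + c) := fun x =>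
    ⟨ciInf_le hbdd x, by
      have : f x - c ≤ ⨅ y, f y := le_ciInf fun y => by linarith [hc x y]
      linarith⟩
  have h := (hasSubgaussianMGF_of_mem_Icc (μ := μ) hf.aemeasurable
    (Filter.Eventually.of_forall hmem)).mgf_le s
  refine h.trans (le_of_eq ?_)
  congr 1
  simp only [add_sub_cancel_left, NNReal.coe_pow, NNReal.coe_div, coe_nnnorm, Real.norm_eq_abs,
    NNReal.coe_ofNat, div_pow, sq_abs]
  ring

lemma abs_exp_mul_le {s a K : ℝ} (h : |a| ≤ K) : |Real.exp (s * a)| ≤ Real.exp (|s| * K) := by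
  rw [Real.abs_exp, Real.exp_le_exp]
  calc s * a ≤ |s * a| := le_abs_self _
    _ = |s| * |a| := abs_mul _ _
    _ ≤ _ := by gcongr

/-- McDiarmid's bound on the moment generating function: the coordinates are integrated out one
after the other, and Hoeffding's lemma bounds the contribution of each of them. -/
lemma mgf_le_of_boundedDifferences_fin (D : Measure 𝓩) [IsProbabilityMeasure D] (n : ℕ)
    (F : (Fin n → 𝓩) → ℝ) (hF : Measurable F) (K : ℝ) (hK : ∀ S, |F S| ≤ K) (c : Fin n → ℝ)
    (hc : ∀ S k z, F (Function.update S k z) - F S ≤ c k) (s : ℝ) :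
    ∫ S, Real.exp (s * (F S - ∫ S', F S' ∂(Measure.pi fun _ => D))) ∂(Measure.pi fun _ => D)
      ≤ Real.exp ((∑ k, c k ^ 2) / 4 * s ^ 2 / 2) := by
  induction n with
  | zero =>
    have : ∀ S : Fin 0 → 𝓩, F S = F default := fun S => by rw [Subsingleton.elim S default]
    simp [this]
  | succ n ih =>
    set P : Measure (Fin n → 𝓩) := Measure.pi fun _ => D with hP
    have hcons : Measurable fun p : 𝓩 × (Fin n → 𝓩) => (Fin.cons p.1 p.2 : Fin (n + 1) → 𝓩) := by
      refine measurable_pi_lambda _ fun i => ?_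
      refine Fin.cases ?_ (fun j => ?_) i
      · simpa using measurable_fst
      · simpa using! (measurable_pi_apply j).comp measurable_snd
    have hFc : Measurable fun p : 𝓩 × (Fin n → 𝓩) => F (Fin.cons p.1 p.2) := hF.comp hcons
    have hF1 : ∀ x, Measurable fun y => F (Fin.cons x y) := fun x =>
      hFc.comp measurable_prodMk_left
    have hint : ∀ x, Integrable (fun y => F (Fin.cons x y)) P := fun x =>
      integrable_of_measurable_of_abs_le (hF1 x) fun y => hK _
    set G : 𝓩 → ℝ := fun x => ∫ y, F (Fin.cons x y) ∂P with hGdef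
    have hG : Measurable G := (hFc.stronglyMeasurable.integral_prod_right).measurable
    have hGK : ∀ x, |G x| ≤ K := fun x => abs_integral_le_of_abs_le fun y => hK _
    have hEF : ∫ S, F S ∂(Measure.pi fun _ => D) = ∫ x, G x ∂D :=
      integral_pi_fin_succ D (integrable_of_measurable_of_abs_le hF hK)
    set m := ∫ x, G x ∂D with hm
    have hmK : |m| ≤ K := abs_integral_le_of_abs_le hGK
    have hKm : ∀ a, |a| ≤ K → |a - m| ≤ 2 * K := fun a ha => by
      have := abs_sub a m
      linarith
    rw [hEF, integral_pi_fin_succ D (integrable_of_measurable_of_abs_le (by fun_prop)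
      fun S => abs_exp_mul_le (hKm _ (hK S)))]
    have hosc : ∀ x y, G x - G y ≤ c 0 := fun x y => by
      rw [hGdef, ← integral_sub (hint x) (hint y)]
      have : ∀ w, F (Fin.cons x w) - F (Fin.cons y w) ≤ c 0 := fun w => by
        simpa [Fin.update_cons_zero] using hc (Fin.cons y w) 0 x
      calc _ ≤ ∫ _, c 0 ∂P := integral_mono ((hint x).sub (hint y)) (integrable_const _) this
        _ = c 0 := by simp
    have hinner : ∀ x, ∫ y, Real.exp (s * (F (Fin.cons x y) - m)) ∂P
        ≤ Real.exp (s * (G x - m)) * Real.exp ((∑ k : Fin n, c k.succ ^ 2) / 4 * s ^ 2 / 2) := by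
      intro x
      have h1 := ih (fun y => F (Fin.cons x y)) (hF1 x) (fun y => hK _) (fun k => c k.succ)
        (fun y k z => by
          have := hc (Fin.cons x y) k.succ z
          rwa [← Fin.cons_update] at this)
      have h2 : ∀ y, Real.exp (s * (F (Fin.cons x y) - m))
          = Real.exp (s * (G x - m)) * Real.exp (s * (F (Fin.cons x y) - G x)) := fun y => by
        rw [← Real.exp_add]; ring_nf
      simp_rw [h2]
      rw [integral_const_mul]
      exact mul_le_mul_of_nonneg_left h1 (Real.exp_nonneg _)
    calc ∫ x, ∫ y, Real.exp (s * (F (Fin.cons x y) - m)) ∂P ∂D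
        ≤ ∫ x, Real.exp (s * (G x - m))
            * Real.exp ((∑ k : Fin n, c k.succ ^ 2) / 4 * s ^ 2 / 2) ∂D := by
          refine integral_mono ?_ ?_ hinner
          · refine integrable_of_measurable_of_abs_le (K := Real.exp (|s| * (2 * K))) ?_ ?_
            · have : Measurable fun p : 𝓩 × (Fin n → 𝓩) =>
                  Real.exp (s * (F (Fin.cons p.1 p.2) - m)) :=
                Real.measurable_exp.comp ((hFc.sub_const m).const_mul s)
              exact (this.stronglyMeasurable.integral_prod_right).measurable
            · exact fun x => abs_integral_le_of_abs_le fun y => abs_exp_mul_le (hKm _ (hK _))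
          · refine Integrable.mul_const ?_ _
            exact integrable_of_measurable_of_abs_le
              (Real.measurable_exp.comp ((hG.sub_const m).const_mul s))
              fun x => abs_exp_mul_le (hKm _ (hGK x))
      _ ≤ Real.exp (c 0 ^ 2 / 4 * s ^ 2 / 2)
            * Real.exp ((∑ k : Fin n, c k.succ ^ 2) / 4 * s ^ 2 / 2) := by
          rw [integral_mul_const]
          exact mul_le_mul_of_nonneg_right
            (mgf_sub_integral_le_of_oscillation_le hG hosc s) (Real.exp_nonneg _)
      _ = _ := by
          rw [← Real.exp_add, Fin.sum_univ_succ]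
          ring_nf

/-- **McDiarmid's inequality**, as a bound on the moment generating function. -/
theorem hasSubgaussianMGF_of_boundedDifferences {ι : Type*} [Fintype ι] [DecidableEq ι]
    (D : Measure 𝓩) [IsProbabilityMeasure D]
    (F : (ι → 𝓩) → ℝ) (hF : Measurable F) (K : ℝ) (hK : ∀ S, |F S| ≤ K) (c : ι → ℝ)
    (hc : ∀ S k z, F (Function.update S k z) - F S ≤ c k) :
    HasSubgaussianMGF (fun S => F S - ∫ S', F S' ∂(Measure.pi fun _ => D))
      (Real.toNNReal ((∑ k, c k ^ 2) / 4)) (Measure.pi fun _ => D) where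
  integrable_exp_mul t := by
    refine integrable_of_measurable_of_abs_le (K := Real.exp (|t| * (2 * K))) (by fun_prop)
      fun S => abs_exp_mul_le ?_
    have h1 : |∫ S', F S' ∂(Measure.pi fun _ : ι => D)| ≤ K := abs_integral_le_of_abs_le hK
    have h2 := abs_sub (F S) (∫ S', F S' ∂(Measure.pi fun _ : ι => D))
    linarith [hK S]
  mgf_le t := by
    let e := (Fintype.equivFin ι).symm
    have hmp := measurePreserving_piCongrLeft (α := fun _ : ι => 𝓩) (fun _ => D) e
    have happ : ∀ S : Fin (Fintype.card ι) → 𝓩,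
        MeasurableEquiv.piCongrLeft (fun _ : ι => 𝓩) e S = fun i => S (e.symm i) := by
      intro S
      ext i
      obtain ⟨j, rfl⟩ := e.surjective i
      simp [MeasurableEquiv.coe_piCongrLeft]
    have hint : ∀ G : (ι → 𝓩) → ℝ, ∫ S, G S ∂(Measure.pi fun _ => D)
        = ∫ S : Fin (Fintype.card ι) → 𝓩, G (fun i => S (e.symm i)) ∂(Measure.pi fun _ => D) := by
      intro G
      rw [← hmp.integral_comp (MeasurableEquiv.measurableEmbedding _)]
      simp_rw [happ]
    rw [mgf, hint, hint F]
    have hsum : ∑ k, c k ^ 2 = ∑ j, c (e j) ^ 2 := (e.sum_comp fun k => c k ^ 2).symm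
    rw [Real.coe_toNNReal _ (by positivity), hsum]
    refine mgf_le_of_boundedDifferences_fin D _ (fun S => F (fun i => S (e.symm i))) ?_ K
      (fun S => hK _) (fun j => c (e j)) (fun S j z => ?_) t
    · exact hF.comp (measurable_pi_lambda _ fun i => measurable_pi_apply _)
    · have := hc (fun i => S (e.symm i)) (e j) z
      convert! this using 3
      ext i
      obtain ⟨j', rfl⟩ := e.surjective i
      simp [Function.update_apply]

/-- **McDiarmid's inequality**: a function of independent variables with nonpositive mean and
bounded differences `c` is at most `√((∑ c²) log (1/δ) / 2)` with probability at least `1 - δ`. -/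
theorem le_measure_of_boundedDifferences {ι : Type*} [Fintype ι] [DecidableEq ι]
    (D : Measure 𝓩) [IsProbabilityMeasure D]
    (F : (ι → 𝓩) → ℝ) (hF : Measurable F) (K : ℝ) (hK : ∀ S, |F S| ≤ K) (c : ι → ℝ)
    (hc : ∀ S k z, F (Function.update S k z) - F S ≤ c k)
    (hm : ∫ S, F S ∂(Measure.pi fun _ => D) ≤ 0) {δ : ℝ} (hδ : 0 < δ) (hδ1 : δ ≤ 1) :
    ENNReal.ofReal (1 - δ) ≤ (Measure.pi fun _ => D)
      {S | F S ≤ √(∑ k, c k ^ 2) * √(Real.log (1 / δ) / 2)} := by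
  have hsub := hasSubgaussianMGF_of_boundedDifferences D F hF K hK c hc
  set P : Measure (ι → 𝓩) := Measure.pi fun _ => D
  have hlog : 0 ≤ Real.log (1 / δ) := Real.log_nonneg (by rw [le_div_iff₀ hδ]; linarith)
  have hs0 : 0 ≤ ∑ k, c k ^ 2 := Finset.sum_nonneg fun k _ => sq_nonneg _
  rcases hs0.eq_or_lt with h0 | hpos
  · -- the degenerate case: `F` is almost surely equal to its mean
    rw [← h0] at hsub ⊢
    have hz :=
      (show HasSubgaussianMGF _ 0 P by simpa using hsub).ae_eq_zero_of_hasSubgaussianMGF_zero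
    have : P {S | F S ≤ √0 * √(Real.log (1 / δ) / 2)} = 1 := by
      refine (mem_ae_iff_prob_eq_one (measurableSet_le hF measurable_const)).1 ?_
      filter_upwards [hz] with S hS
      simp only [Pi.zero_apply] at hS
      simp only [Real.sqrt_zero, zero_mul]
      linarith
    rw [this]
    exact ENNReal.ofReal_le_one.2 (by linarith)
  · set x := √(∑ k, c k ^ 2) * √(Real.log (1 / δ) / 2) with hx
    have htail := hsub.measure_ge_le (ε := x) (by positivity)
    have hexp : Real.exp (-x ^ 2 / (2 * (Real.toNNReal ((∑ k, c k ^ 2) / 4) : ℝ))) = δ := by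
      rw [Real.coe_toNNReal _ (by positivity), hx, mul_pow, Real.sq_sqrt hs0,
        Real.sq_sqrt (by positivity)]
      have : -((∑ k, c k ^ 2) * (Real.log (1 / δ) / 2)) / (2 * ((∑ k, c k ^ 2) / 4))
          = Real.log δ := by
        rw [one_div, Real.log_inv]
        field_simp
        ring
      rw [this, Real.exp_log hδ]
    rw [hexp] at htail
    have hms : MeasurableSet {S | F S ≤ x} := measurableSet_le hF measurable_const
    have hcompl : P.real {S | F S ≤ x}ᶜ ≤ δ := by
      refine (measureReal_mono ?_).trans htail
      intro S hS
      simp only [Set.mem_compl_iff, Set.mem_ofPred_eq, not_le] at hS ⊢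
      linarith
    rw [probReal_compl_eq_one_sub hms] at hcompl
    rw [ENNReal.ofReal_le_iff_le_toReal (measure_ne_top _ _)]
    change _ ≤ P.real _
    linarith

end HWnet

/-! ### Rademacher averages and symmetrization -/

namespace HWnet

section Suprema

variable {Q : Type*}

lemma bddAbove_range_of_abs_le {f : Q → ℝ} {C : ℝ} (h : ∀ q, |f q| ≤ C) :
    BddAbove (Set.range f) :=
  ⟨C, by rintro _ ⟨q, rfl⟩; exact (abs_le.1 (h q)).2⟩

lemma abs_ciSup_le [Nonempty Q] {f : Q → ℝ} {C : ℝ} (h : ∀ q, |f q| ≤ C) : |⨆ q, f q| ≤ C := by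
  obtain ⟨q₀⟩ := ‹Nonempty Q›
  have : Nonempty Q := ⟨q₀⟩
  exact abs_le.2 ⟨(abs_le.1 (h q₀)).1.trans (le_ciSup (bddAbove_range_of_abs_le h) q₀),
    ciSup_le fun q => (abs_le.1 (h q)).2⟩

lemma abs_sum_le_sum_of_abs_le {ι : Type*} [Fintype ι] {x b : ι → ℝ} (h : ∀ k, |x k| ≤ b k) :
    |∑ k, x k| ≤ ∑ k, b k :=
  (Finset.abs_sum_le_sum_abs _ _).trans (Finset.sum_le_sum fun k _ => h k)

end Suprema

/-- The sign `±1` encoded by a truth value. -/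
noncomputable def boolSign (s : Bool) : ℝ := if s then 1 else -1

lemma abs_boolSign_mul (s : Bool) (x : ℝ) : |boolSign s * x| = |x| := by
  cases s <;> simp [boolSign]

lemma boolSign_not (s : Bool) : boolSign (!s) = -boolSign s := by
  cases s <;> simp [boolSign]

section Rademacher

variable {ι : Type*} [Fintype ι] {Q : Type*}

/-- The Rademacher average `𝔼_σ sup_q ∑ₖ σₖ xₖ(q)` of a finite family of functions on `Q`; the
expectation over the signs is a finite average. -/
noncomputable def radAvg [DecidableEq ι] (x : ι → Q → ℝ) : ℝ :=
  (2 ^ Fintype.card ι)⁻¹ * ∑ σ : ι → Bool, ⨆ q, ∑ k, boolSign (σ k) * x k q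

lemma abs_sum_boolSign_mul_le {x : ι → ℝ} {b : ι → ℝ} (h : ∀ k, |x k| ≤ b k) (σ : ι → Bool) :
    |∑ k, boolSign (σ k) * x k| ≤ ∑ k, b k :=
  abs_sum_le_sum_of_abs_le fun k => by rw [abs_boolSign_mul]; exact h k

lemma card_bool_fun [DecidableEq ι] :
    ((Finset.univ : Finset (ι → Bool)).card : ℝ) = 2 ^ Fintype.card ι := by
  simp

/-- Changing one of the functions, all bounded by `b`, changes the Rademacher average by at most `b`
(and not merely `2 b`): the average over the sign of the changed function lies between
`sup A` and `sup A + b`, where `A` is the sum of the remaining terms. -/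
lemma radAvg_sub_radAvg_le [DecidableEq ι] [Nonempty Q] {x y : ι → Q → ℝ} {b : ι → ℝ}
    (hx : ∀ k q, |x k q| ≤ b k)
    (hy : ∀ k q, |y k q| ≤ b k) (k : ι) (hxy : ∀ j, j ≠ k → x j = y j) :
    radAvg x - radAvg y ≤ b k := by
  let flip : (ι → Bool) → (ι → Bool) := fun σ => Function.update σ k (!σ k)
  have hflip : Function.Involutive flip := fun σ => by
    ext j
    by_cases hj : j = k
    · subst hj; simp [flip]
    · simp [flip, hj]
  let V : (ι → Q → ℝ) → (ι → Bool) → ℝ := fun x σ => ⨆ q, ∑ k, boolSign (σ k) * x k q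
  have hsymm : ∀ x, 2 * ∑ σ, V x σ = ∑ σ, (V x σ + V x (flip σ)) := fun x => by
    rw [Finset.sum_add_distrib, two_mul, hflip.bijective.sum_comp (V x)]
  have hsplit : ∀ (x : ι → Q → ℝ) (σ : ι → Bool) q, ∑ j, boolSign (σ j) * x j q
      = ∑ j ∈ Finset.univ.erase k, boolSign (σ j) * x j q + boolSign (σ k) * x k q := fun x σ q =>
    (Finset.sum_erase_add _ _ (Finset.mem_univ k)).symm
  have hsplit' : ∀ (x : ι → Q → ℝ) (σ : ι → Bool) q, ∑ j, boolSign (flip σ j) * x j q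
      = ∑ j ∈ Finset.univ.erase k, boolSign (σ j) * x j q - boolSign (σ k) * x k q := by
    intro x σ q
    rw [hsplit]
    have h1 : boolSign (flip σ k) = -boolSign (σ k) := by simp [flip, boolSign_not]
    rw [h1, neg_mul, ← sub_eq_add_neg]
    congr 1
    refine Finset.sum_congr rfl fun j hj => ?_
    simp [flip, Finset.ne_of_mem_erase hj]
  have hbd : ∀ x : ι → Q → ℝ, (∀ k q, |x k q| ≤ b k) → ∀ σ : ι → Bool,
      BddAbove (Set.range fun q => ∑ j, boolSign (σ j) * x j q) := fun x hx σ =>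
    bddAbove_range_of_abs_le fun q => abs_sum_boolSign_mul_le (fun k => hx k q) σ
  have hbdA : ∀ σ : ι → Bool, BddAbove (Set.range fun q =>
      ∑ j ∈ Finset.univ.erase k, boolSign (σ j) * y j q) := by
    intro σ
    refine bddAbove_range_of_abs_le (C := ∑ j ∈ Finset.univ.erase k, b j) fun q => ?_
    refine (Finset.abs_sum_le_sum_abs _ _).trans (Finset.sum_le_sum fun j _ => ?_)
    rw [abs_boolSign_mul]
    exact hy j q
  have hkey : ∀ σ, V x σ + V x (flip σ) ≤ V y σ + V y (flip σ) + 2 * b k := by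
    intro σ
    set A : Q → ℝ := fun q => ∑ j ∈ Finset.univ.erase k, boolSign (σ j) * y j q with hA
    have hAx : ∀ q, ∑ j ∈ Finset.univ.erase k, boolSign (σ j) * x j q = A q := fun q =>
      Finset.sum_congr rfl fun j hj => by rw [hxy j (Finset.ne_of_mem_erase hj)]
    have hup : ∀ q, |boolSign (σ k) * x k q| ≤ b k := fun q => by
      rw [abs_boolSign_mul]; exact hx k q
    have h1 : V x σ ≤ (⨆ q, A q) + b k := ciSup_le fun q => by
      rw [hsplit, hAx]
      exact add_le_add (le_ciSup (hbdA σ) q) (abs_le.1 (hup q)).2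
    have h2 : V x (flip σ) ≤ (⨆ q, A q) + b k := ciSup_le fun q => by
      rw [hsplit', hAx]
      have := le_ciSup (hbdA σ) q
      have := (abs_le.1 (hup q)).1
      linarith
    have h3 : (⨆ q, A q) ≤ (V y σ + V y (flip σ)) / 2 := ciSup_le fun q => by
      have e1 : A q + boolSign (σ k) * y k q ≤ V y σ := by
        rw [hA, ← hsplit]
        exact le_ciSup (hbd y hy σ) q
      have e2 : A q - boolSign (σ k) * y k q ≤ V y (flip σ) := by
        rw [hA, ← hsplit']
        exact le_ciSup (hbd y hy (flip σ)) q
      linarith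
    linarith
  have hsum : 2 * ∑ σ, V x σ ≤ 2 * ∑ σ, V y σ + 2 ^ Fintype.card ι * (2 * b k) := by
    rw [hsymm, hsymm, ← card_bool_fun, ← nsmul_eq_mul, ← Finset.sum_const,
      ← Finset.sum_add_distrib]
    exact Finset.sum_le_sum fun σ _ => hkey σ
  have hpos : (0 : ℝ) < 2 ^ Fintype.card ι := by positivity
  change (2 ^ Fintype.card ι : ℝ)⁻¹ * ∑ σ, V x σ - (2 ^ Fintype.card ι : ℝ)⁻¹ * ∑ σ, V y σ ≤ b k
  rw [← mul_sub, inv_mul_le_iff₀ hpos]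
  linarith

end Rademacher

lemma measurable_radAvg {ι : Type*} [Fintype ι] [DecidableEq ι] {Q : Type*} [Countable Q]
    {𝓩 : Type*} [MeasurableSpace 𝓩] {φ : ι → Q → 𝓩 → ℝ} (hφ : ∀ k q, Measurable (φ k q)) :
    Measurable fun S : ι → 𝓩 => radAvg fun k q => φ k q (S k) := by
  refine Measurable.const_mul (Finset.measurable_sum _ fun σ _ => Measurable.iSup fun q => ?_) _
  exact Finset.measurable_sum _ fun k _ =>
    ((hφ k q).comp (measurable_pi_apply k)).const_mul _

lemma measurable_iSup_sum_boolSign {ι : Type*} [Fintype ι] {Q : Type*} [Countable Q]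
    {𝓩 : Type*} [MeasurableSpace 𝓩] {φ : ι → Q → 𝓩 → ℝ} (hφ : ∀ k q, Measurable (φ k q))
    (σ : ι → Bool) :
    Measurable fun S : ι → 𝓩 => ⨆ q, ∑ k, boolSign (σ k) * φ k q (S k) :=
  Measurable.iSup fun q => Finset.measurable_sum _ fun k _ =>
    ((hφ k q).comp (measurable_pi_apply k)).const_mul _

lemma abs_iSup_sum_boolSign_le {ι : Type*} [Fintype ι] {Q : Type*} [Nonempty Q]
    {𝓩 : Type*} {φ : ι → Q → 𝓩 → ℝ}
    {b : ι → ℝ} (hb : ∀ k q z, |φ k q z| ≤ b k) (σ : ι → Bool) (S : ι → 𝓩) :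
    |⨆ q, ∑ k, boolSign (σ k) * φ k q (S k)| ≤ ∑ k, b k :=
  abs_ciSup_le fun q => abs_sum_boolSign_mul_le (fun k => hb k q (S k)) σ

lemma abs_radAvg_le {ι : Type*} [Fintype ι] [DecidableEq ι] {Q : Type*} [Nonempty Q]
    {b : ι → ℝ} {x : ι → Q → ℝ} (hb : ∀ k q, |x k q| ≤ b k) : |radAvg x| ≤ ∑ k, b k := by
  have hpos : (0 : ℝ) < 2 ^ Fintype.card ι := by positivity
  rw [radAvg, abs_mul, abs_of_pos (inv_pos.2 hpos), inv_mul_le_iff₀ hpos, ← card_bool_fun,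
    ← nsmul_eq_mul, ← Finset.sum_const]
  exact (Finset.abs_sum_le_sum_abs _ _).trans (Finset.sum_le_sum fun σ _ =>
    abs_ciSup_le fun q => abs_sum_boolSign_mul_le (fun k => hb k q) σ)

/-- Comparison with an independent copy of the sample. -/
lemma integral_iSup_deviation_le_ghost {ι : Type*} [Fintype ι]
    {Q : Type*} [Countable Q] [Nonempty Q] {𝓩 : Type*} [MeasurableSpace 𝓩]
    (D : Measure 𝓩) [IsProbabilityMeasure D] {φ : ι → Q → 𝓩 → ℝ} {b : ι → ℝ}
    (hφ : ∀ k q, Measurable (φ k q)) (hb : ∀ k q z, |φ k q z| ≤ b k) :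
    ∫ S, (⨆ q, ∑ k, (∫ z, φ k q z ∂D - φ k q (S k))) ∂(Measure.pi fun _ : ι => D)
      ≤ ∫ w, (⨆ q, ∑ k, (φ k q (w k).2 - φ k q (w k).1))
          ∂(Measure.pi fun _ : ι => D.prod D) := by
  set P : Measure (ι → 𝓩) := Measure.pi fun _ : ι => D
  have hmp := measurePreserving_arrowProdEquivProdArrow 𝓩 𝓩 ι (fun _ => D) (fun _ => D)
  let H : (ι → 𝓩) × (ι → 𝓩) → ℝ := fun p => ⨆ q, ∑ k, (φ k q (p.2 k) - φ k q (p.1 k))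
  have hHm : Measurable H := Measurable.iSup fun q => Finset.measurable_sum _ fun k _ =>
    ((hφ k q).comp ((measurable_pi_apply k).comp measurable_snd)).sub
      ((hφ k q).comp ((measurable_pi_apply k).comp measurable_fst))
  have habs : ∀ (p : (ι → 𝓩) × (ι → 𝓩)) q,
      |∑ k, (φ k q (p.2 k) - φ k q (p.1 k))| ≤ ∑ k, 2 * b k := fun p q =>
    abs_sum_le_sum_of_abs_le fun k => by
      have := abs_sub (φ k q (p.2 k)) (φ k q (p.1 k))
      linarith [hb k q (p.2 k), hb k q (p.1 k)]
  have hHb : ∀ p, |H p| ≤ ∑ k, 2 * b k := fun p => abs_ciSup_le (habs p)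
  have hHi : Integrable H (P.prod P) := integrable_of_measurable_of_abs_le hHm hHb
  have hright : ∫ w, (⨆ q, ∑ k, (φ k q (w k).2 - φ k q (w k).1))
      ∂(Measure.pi fun _ : ι => D.prod D) = ∫ S, ∫ S', H (S, S') ∂P ∂P := by
    rw [← integral_prod _ hHi, ← hmp.integral_comp (MeasurableEquiv.measurableEmbedding _)]
    rfl
  have hφi : ∀ k q, Integrable (fun S' : ι → 𝓩 => φ k q (S' k)) P := fun k q =>
    integrable_of_measurable_of_abs_le ((hφ k q).comp (measurable_pi_apply k)) fun S' => hb k q _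
  have hφs : ∀ k q c, Integrable (fun S' : ι → 𝓩 => φ k q (S' k) - c) P := fun k q c =>
    (hφi k q).sub (integrable_const c)
  have hmean : ∀ k q, ∫ S', φ k q (S' k) ∂P = ∫ z, φ k q z ∂D := fun k q =>
    integral_comp_eval (μ := fun _ : ι => D) (i := k) (hφ k q).aestronglyMeasurable
  rw [hright]
  refine integral_mono ?_ hHi.integral_prod_left fun S => ciSup_le fun q => ?_
  · refine integrable_of_measurable_of_abs_le (K := ∑ k, 2 * b k) ?_ fun S => abs_ciSup_le fun q =>
      abs_sum_le_sum_of_abs_le fun k => ?_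
    · exact Measurable.iSup fun q => Finset.measurable_sum _ fun k _ =>
        ((hφ k q).comp (measurable_pi_apply k)).const_sub _
    · have h1 := abs_sub (∫ z, φ k q z ∂D) (φ k q (S k))
      have h2 : |∫ z, φ k q z ∂D| ≤ b k := abs_integral_le_of_abs_le (hb k q)
      linarith [hb k q (S k)]
  · have hsum : ∑ k, (∫ z, φ k q z ∂D - φ k q (S k))
        = ∫ S', ∑ k, (φ k q (S' k) - φ k q (S k)) ∂P := by
      rw [integral_finsetSum _ fun k _ => hφs k q _]
      refine Finset.sum_congr rfl fun k _ => ?_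
      rw [integral_sub (hφi k q) (integrable_const _), hmean]
      simp
    rw [hsum]
    refine integral_mono (integrable_finsetSum _ fun k _ => hφs k q _)
      (integrable_of_measurable_of_abs_le (hHm.comp measurable_prodMk_left) fun S' => hHb _)
      fun S' => ?_
    exact le_ciSup (bddAbove_range_of_abs_le (habs (S, S'))) q

/-- **Symmetrization**: the expected one-sided uniform deviation is at most twice the expected
Rademacher average. -/
theorem integral_iSup_deviation_le {ι : Type*} [Fintype ι] [DecidableEq ι]
    {Q : Type*} [Countable Q] [Nonempty Q] {𝓩 : Type*} [MeasurableSpace 𝓩]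
    (D : Measure 𝓩) [IsProbabilityMeasure D] {φ : ι → Q → 𝓩 → ℝ} {b : ι → ℝ}
    (hφ : ∀ k q, Measurable (φ k q)) (hb : ∀ k q z, |φ k q z| ≤ b k) :
    ∫ S, (⨆ q, ∑ k, (∫ z, φ k q z ∂D - φ k q (S k))) ∂(Measure.pi fun _ : ι => D)
      ≤ 2 * ∫ S, radAvg (fun k q => φ k q (S k)) ∂(Measure.pi fun _ : ι => D) := by
  refine (integral_iSup_deviation_le_ghost D hφ hb).trans ?_
  set P : Measure (ι → 𝓩) := Measure.pi fun _ : ι => D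
  set PP : Measure (ι → 𝓩 × 𝓩) := Measure.pi fun _ : ι => D.prod D
  let a : (ι → Bool) → ℝ := fun σ => ∫ S, (⨆ q, ∑ k, boolSign (σ k) * φ k q (S k)) ∂P
  have ha : ∀ σ : ι → Bool,
      Integrable (fun S : ι → 𝓩 => ⨆ q, ∑ k, boolSign (σ k) * φ k q (S k)) P :=
    fun σ => integrable_of_measurable_of_abs_le (measurable_iSup_sum_boolSign hφ σ)
      (abs_iSup_sum_boolSign_le hb σ)
  have hfst : MeasurePreserving (fun (w : ι → 𝓩 × 𝓩) k => (w k).1) PP P :=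
    measurePreserving_pi _ _ fun _ => measurePreserving_fst
  have hsnd : MeasurePreserving (fun (w : ι → 𝓩 × 𝓩) k => (w k).2) PP P :=
    measurePreserving_pi _ _ fun _ => measurePreserving_snd
  set E := ∫ w, (⨆ q, ∑ k, (φ k q (w k).2 - φ k q (w k).1)) ∂PP with hE
  -- swapping the two copies of the coordinates with a negative sign preserves the measure
  have hσ : ∀ σ : ι → Bool, E ≤ a σ + a (fun k => !σ k) := by
    intro σ
    let sw : Bool → 𝓩 × 𝓩 → 𝓩 × 𝓩 := fun s p => if s then p else p.swap
    have hsw : ∀ s, MeasurePreserving (sw s) (D.prod D) (D.prod D) := fun s => by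
      cases s
      · exact Measure.measurePreserving_swap
      · exact MeasurePreserving.id _
    have hswp : MeasurePreserving (fun (w : ι → 𝓩 × 𝓩) k => sw (σ k) (w k)) PP PP :=
      measurePreserving_pi _ _ fun k => hsw (σ k)
    have hmeas : Measurable fun w : ι → 𝓩 × 𝓩 => ⨆ q, ∑ k, (φ k q (w k).2 - φ k q (w k).1) :=
      Measurable.iSup fun q => Finset.measurable_sum _ fun k _ =>
        ((hφ k q).comp (measurable_snd.comp (measurable_pi_apply k))).sub
          ((hφ k q).comp (measurable_fst.comp (measurable_pi_apply k)))
    have hEσ : E = ∫ w, (⨆ q, ∑ k, boolSign (σ k) * (φ k q (w k).2 - φ k q (w k).1)) ∂PP := by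
      rw [hE, ← hswp.map_eq, integral_map hswp.aemeasurable (by
        rw [hswp.map_eq]; exact hmeas.aestronglyMeasurable), hswp.map_eq]
      congr 1
      ext w
      refine iSup_congr fun q => Finset.sum_congr rfl fun k _ => ?_
      cases h : σ k <;> simp [sw, boolSign, h]
    have hi2 : Integrable (fun w : ι → 𝓩 × 𝓩 => ⨆ q, ∑ k, boolSign (σ k) * φ k q (w k).2) PP :=
      hsnd.integrable_comp_of_integrable (ha σ)
    have hi1 : Integrable (fun w : ι → 𝓩 × 𝓩 =>
        ⨆ q, ∑ k, boolSign (!σ k) * φ k q (w k).1) PP :=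
      hfst.integrable_comp_of_integrable (ha fun k => !σ k)
    have e2 : a σ = ∫ w, (⨆ q, ∑ k, boolSign (σ k) * φ k q (w k).2) ∂PP := by
      simp only [a]
      rw [← hsnd.map_eq, integral_map hsnd.aemeasurable
        (measurable_iSup_sum_boolSign hφ σ).aestronglyMeasurable]
    have e1 : a (fun k => !σ k) = ∫ w, (⨆ q, ∑ k, boolSign (!σ k) * φ k q (w k).1) ∂PP := by
      simp only [a]
      rw [← hfst.map_eq, integral_map hfst.aemeasurable
        (measurable_iSup_sum_boolSign hφ fun k => !σ k).aestronglyMeasurable]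
    rw [hEσ, e1, e2, ← integral_add hi2 hi1]
    refine integral_mono ?_ (hi2.add hi1) fun w => ciSup_le fun q => ?_
    · refine integrable_of_measurable_of_abs_le (K := ∑ k, 2 * b k) ?_ fun w =>
        abs_ciSup_le fun q => abs_sum_boolSign_mul_le (fun k => ?_) σ
      · exact Measurable.iSup fun q => Finset.measurable_sum _ fun k _ =>
          (((hφ k q).comp (measurable_snd.comp (measurable_pi_apply k))).sub
            ((hφ k q).comp (measurable_fst.comp (measurable_pi_apply k)))).const_mul _
      · have := abs_sub (φ k q (w k).2) (φ k q (w k).1)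
        linarith [hb k q (w k).2, hb k q (w k).1]
    · have h2 := le_ciSup (bddAbove_range_of_abs_le fun q =>
        abs_sum_boolSign_mul_le (fun k => hb k q (w k).2) σ) q
      have h1 := le_ciSup (bddAbove_range_of_abs_le fun q =>
        abs_sum_boolSign_mul_le (fun k => hb k q (w k).1) fun k => !σ k) q
      refine le_trans (le_of_eq ?_) (add_le_add h2 h1)
      rw [← Finset.sum_add_distrib]
      refine Finset.sum_congr rfl fun k _ => ?_
      rw [boolSign_not]
      ring
  have hnot : ∑ σ : ι → Bool, a (fun k => !σ k) = ∑ σ, a σ := by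
    have : Function.Involutive fun (σ : ι → Bool) k => !σ k := fun σ => by ext k; simp
    exact this.bijective.sum_comp a
  have hsum : 2 ^ Fintype.card ι * E ≤ 2 * ∑ σ, a σ := by
    calc 2 ^ Fintype.card ι * E = ∑ _σ : ι → Bool, E := by
          rw [Finset.sum_const, nsmul_eq_mul, card_bool_fun]
      _ ≤ ∑ σ, (a σ + a (fun k => !σ k)) := Finset.sum_le_sum fun σ _ => hσ σ
      _ = 2 * ∑ σ, a σ := by rw [Finset.sum_add_distrib, hnot]; ring
  have hrad : ∫ S, radAvg (fun k q => φ k q (S k)) ∂P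
      = (2 ^ Fintype.card ι)⁻¹ * ∑ σ, a σ := by
    simp only [radAvg]
    rw [integral_const_mul, integral_finsetSum _ fun σ _ => ha σ]
  have hpos : (0 : ℝ) < 2 ^ Fintype.card ι := by positivity
  rw [hrad, ← mul_assoc, mul_comm (2 : ℝ), mul_assoc, ← div_eq_inv_mul, le_div_iff₀ hpos]
  linarith

/-- The one-sided uniform deviation, the fluctuation of one fixed function `q₀` and the
Rademacher average are controlled simultaneously by a single application of McDiarmid's
inequality, to a function whose `k`-th difference is bounded by `2 bₖ + 2 bₖ + 2 bₖ`. -/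
theorem measure_iSup_deviation_le {ι : Type*} [Fintype ι] [DecidableEq ι]
    {Q : Type*} [Countable Q] [Nonempty Q] {𝓩 : Type*} [MeasurableSpace 𝓩]
    (D : Measure 𝓩) [IsProbabilityMeasure D] {φ : ι → Q → 𝓩 → ℝ} {b : ι → ℝ}
    (hφ : ∀ k q, Measurable (φ k q)) (hb : ∀ k q z, |φ k q z| ≤ b k)
    (q₀ : Q) {δ : ℝ} (hδ : 0 < δ) (hδ1 : δ ≤ 1) :
    ∃ A : Set (ι → 𝓩), MeasurableSet A ∧ ENNReal.ofReal (1 - δ) ≤ (Measure.pi fun _ => D) A ∧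
      ∀ S ∈ A, (⨆ q, ∑ k, (∫ z, φ k q z ∂D - φ k q (S k)))
        + ∑ k, (φ k q₀ (S k) - ∫ z, φ k q₀ z ∂D)
        ≤ 2 * radAvg (fun k q => φ k q (S k))
          + 6 * √(∑ k, b k ^ 2) * √(Real.log (1 / δ) / 2) := by
  set P : Measure (ι → 𝓩) := Measure.pi fun _ : ι => D
  have hIb : ∀ k q, |∫ z, φ k q z ∂D| ≤ b k := fun k q => abs_integral_le_of_abs_le (hb k q)
  have hdevb : ∀ k q z, |∫ z, φ k q z ∂D - φ k q z| ≤ 2 * b k := fun k q z => by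
    have := abs_sub (∫ z, φ k q z ∂D) (φ k q z)
    linarith [hb k q z, hIb k q]
  have hdevs : ∀ (S : ι → 𝓩) q, |∑ k, (∫ z, φ k q z ∂D - φ k q (S k))| ≤ ∑ k, 2 * b k :=
    fun S q => abs_sum_le_sum_of_abs_le fun k => hdevb k q (S k)
  let U : (ι → 𝓩) → ℝ := fun S => ⨆ q, ∑ k, (∫ z, φ k q z ∂D - φ k q (S k))
  let W : (ι → 𝓩) → ℝ := fun S => ∑ k, (φ k q₀ (S k) - ∫ z, φ k q₀ z ∂D)
  let V : (ι → 𝓩) → ℝ := fun S => radAvg fun k q => φ k q (S k)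
  have hU : Measurable U := Measurable.iSup fun q => Finset.measurable_sum _ fun k _ =>
    ((hφ k q).comp (measurable_pi_apply k)).const_sub _
  have hW : Measurable W := Finset.measurable_sum _ fun k _ =>
    ((hφ k q₀).comp (measurable_pi_apply k)).sub_const _
  have hV : Measurable V := measurable_radAvg hφ
  have hUb : ∀ S, |U S| ≤ ∑ k, 2 * b k := fun S => abs_ciSup_le (hdevs S)
  have hWb : ∀ S, |W S| ≤ ∑ k, 2 * b k := fun S => abs_sum_le_sum_of_abs_le fun k => by
    rw [abs_sub_comm]; exact hdevb k q₀ (S k)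
  have hVb : ∀ S, |V S| ≤ ∑ k, b k := fun S => abs_radAvg_le fun k q => hb k q (S k)
  have hUi : Integrable U P := integrable_of_measurable_of_abs_le hU hUb
  have hWi : Integrable W P := integrable_of_measurable_of_abs_le hW hWb
  have hVi : Integrable V P := integrable_of_measurable_of_abs_le hV hVb
  let F : (ι → 𝓩) → ℝ := fun S => U S + W S - 2 * V S
  have hF : Measurable F := (hU.add hW).sub (hV.const_mul 2)
  have hFb : ∀ S, |F S| ≤ (∑ k, 2 * b k) + (∑ k, 2 * b k) + 2 * ∑ k, b k := fun S => by
    have h1 := abs_le.1 (hUb S)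
    have h2 := abs_le.1 (hWb S)
    have h3 := abs_le.1 (hVb S)
    exact abs_le.2 ⟨by simp only [F]; linarith, by simp only [F]; linarith⟩
  have hφi : ∀ k q, Integrable (fun S : ι → 𝓩 => φ k q (S k)) P := fun k q =>
    integrable_of_measurable_of_abs_le ((hφ k q).comp (measurable_pi_apply k)) fun S' => hb k q _
  have hφs : ∀ k q c, Integrable (fun S' : ι → 𝓩 => φ k q (S' k) - c) P := fun k q c =>
    (hφi k q).sub (integrable_const c)
  have hWmean : ∫ S, W S ∂P = 0 := by
    simp only [W]
    rw [integral_finsetSum _ fun k _ => hφs k q₀ _]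
    refine Finset.sum_eq_zero fun k _ => ?_
    rw [integral_sub (hφi k q₀) (integrable_const _), sub_eq_zero]
    have := integral_comp_eval (μ := fun _ : ι => D) (i := k) (hφ k q₀).aestronglyMeasurable
    simpa using this
  have hmean : ∫ S, F S ∂P ≤ 0 := by
    have h1 : ∫ S, F S ∂P = ∫ S, U S ∂P + ∫ S, W S ∂P - 2 * ∫ S, V S ∂P := by
      have hUW : Integrable (fun S => U S + W S) P := hUi.add hWi
      simp only [F]
      rw [integral_sub hUW (hVi.const_mul 2), integral_add hUi hWi, integral_const_mul]
    have h2 : ∫ S, U S ∂P ≤ 2 * ∫ S, V S ∂P := integral_iSup_deviation_le D hφ hb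
    linarith
  have hdiff : ∀ S k z, F (Function.update S k z) - F S ≤ 6 * b k := by
    intro S k z
    set S' := Function.update S k z with hS'
    have hne : ∀ j, j ≠ k → S' j = S j := fun j hj => by simp [hS', hj]
    have hsum : ∀ f : ι → 𝓩 → ℝ, ∑ j, f j (S' j) = ∑ j, f j (S j) + (f k z - f k (S k)) := by
      intro f
      rw [← Finset.sum_erase_add _ _ (Finset.mem_univ k),
        ← Finset.sum_erase_add Finset.univ (fun j => f j (S j)) (Finset.mem_univ k),
        Finset.sum_congr rfl fun j hj => by rw [hne j (Finset.ne_of_mem_erase hj)]]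
      have : S' k = z := by simp [hS']
      rw [this]
      ring
    have hUd : U S' ≤ U S + 2 * b k := ciSup_le fun q => by
      rw [hsum fun j z => ∫ z, φ j q z ∂D - φ j q z]
      have h1 := le_ciSup (bddAbove_range_of_abs_le (hdevs S)) q
      have h2 := abs_le.1 (hb k q z)
      have h3 := abs_le.1 (hb k q (S k))
      change _ ≤ U S at h1
      linarith
    have hWd : W S' ≤ W S + 2 * b k := by
      simp only [W]
      rw [hsum fun j z => φ j q₀ z - ∫ z, φ j q₀ z ∂D]
      have h2 := abs_le.1 (hb k q₀ z)
      have h3 := abs_le.1 (hb k q₀ (S k))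
      linarith
    have hVd : V S - V S' ≤ b k := radAvg_sub_radAvg_le (fun j q => hb j q _)
      (fun j q => hb j q _) k fun j hj => by rw [hne j hj]
    simp only [F]
    linarith
  refine ⟨{S | F S ≤ √(∑ k, (6 * b k) ^ 2) * √(Real.log (1 / δ) / 2)},
    measurableSet_le hF measurable_const,
    le_measure_of_boundedDifferences D F hF _ hFb _ hdiff hmean hδ hδ1, fun S hS => ?_⟩
  have hsq : √(∑ k, (6 * b k) ^ 2) = 6 * √(∑ k, b k ^ 2) := by
    simp_rw [mul_pow, ← Finset.mul_sum]
    rw [Real.sqrt_mul (by positivity), Real.sqrt_sq (by norm_num)]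
  have hS' : U S + W S - 2 * V S ≤ √(∑ k, (6 * b k) ^ 2) * √(Real.log (1 / δ) / 2) := hS
  rw [hsq] at hS'
  change U S + W S ≤ 2 * V S + _
  linarith

end HWnet

/-! ### Comparison of Rademacher and Gaussian averages -/

namespace HWnet

variable {κ : Type*} [Fintype κ]

/-- The standard Gaussian measure on `κ → ℝ`. -/
noncomputable abbrev gaussPi (κ : Type*) [Fintype κ] : Measure (κ → ℝ) :=
  Measure.pi fun _ => gaussianReal 0 1

lemma integrable_eval_gaussPi (m : κ) : Integrable (fun g : κ → ℝ => g m) (gaussPi κ) :=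
  integrable_comp_eval (μ := fun _ : κ => gaussianReal 0 1) (f := fun x : ℝ => x)
    ((memLp_id_gaussianReal 1).integrable le_rfl)

lemma integrable_sum_mul_gaussPi (u : κ → ℝ) :
    Integrable (fun g : κ → ℝ => ∑ m, g m * u m) (gaussPi κ) :=
  integrable_finsetSum _ fun m _ => (integrable_eval_gaussPi m).mul_const _

lemma integral_cos_sum_gaussPi (u : κ → ℝ) :
    ∫ g, Real.cos (∑ m, g m * u m) ∂(gaussPi κ) = Real.exp (-(∑ m, u m ^ 2) / 2) := by
  have h1 : ∀ g : κ → ℝ, Complex.exp (((∑ m, g m * u m : ℝ) : ℂ) * Complex.I)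
      = ∏ m, Complex.exp ((u m : ℂ) * (g m : ℂ) * Complex.I) := fun g => by
    rw [← Complex.exp_sum]
    push_cast
    rw [Finset.sum_mul]
    congr 1
    exact Finset.sum_congr rfl fun m _ => by ring
  have h2 : ∫ g, Complex.exp (((∑ m, g m * u m : ℝ) : ℂ) * Complex.I) ∂(gaussPi κ)
      = Complex.exp (-(∑ m, u m ^ 2 : ℝ) / 2) := by
    simp_rw [h1]
    rw [integral_fintype_prod_eq_prod (μ := fun _ : κ => gaussianReal 0 1)
      (fun m (x : ℝ) => Complex.exp ((u m : ℂ) * (x : ℂ) * Complex.I))]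
    have : ∀ m, ∫ x : ℝ, Complex.exp ((u m : ℂ) * (x : ℂ) * Complex.I) ∂(gaussianReal 0 1)
        = Complex.exp (-(u m : ℂ) ^ 2 / 2) := fun m => by
      rw [← charFun_apply_real, charFun_gaussianReal]
      simp [neg_div]
    simp_rw [this]
    rw [← Complex.exp_sum]
    push_cast
    rw [← Finset.sum_div, Finset.sum_neg_distrib]
  have hint : Integrable (fun g : κ → ℝ =>
      Complex.exp (((∑ m, g m * u m : ℝ) : ℂ) * Complex.I)) (gaussPi κ) := by
    refine Integrable.of_bound (C := 1) ?_ (Filter.Eventually.of_forall fun g => ?_)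
    · exact Continuous.aestronglyMeasurable (by fun_prop)
    · rw [Complex.norm_exp_ofReal_mul_I]
  have h3 := integral_re (𝕜 := ℂ) hint
  have h4 : ∀ g : κ → ℝ, RCLike.re (Complex.exp (((∑ m, g m * u m : ℝ) : ℂ) * Complex.I))
      = Real.cos (∑ m, g m * u m) := fun g => Complex.exp_ofReal_mul_I_re _
  simp_rw [h4] at h3
  rw [h3, h2]
  have : (-((∑ m, u m ^ 2 : ℝ) : ℂ) / 2) = ((-(∑ m, u m ^ 2) / 2 : ℝ) : ℂ) := by push_cast; rfl
  rw [this]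
  exact Complex.exp_ofReal_re _

/-- A lower bound for the first absolute moment of a linear form in standard Gaussian variables,
from `1 - cos x ≤ |x|` and the value `exp (-1/2)` of the characteristic function. -/
lemma sqrt_sum_sq_le_integral_abs (u : κ → ℝ) :
    √(∑ m, u m ^ 2) ≤ 3 * ∫ g, |∑ m, g m * u m| ∂(gaussPi κ) := by
  set s := √(∑ m, u m ^ 2) with hs
  have hs2 : s ^ 2 = ∑ m, u m ^ 2 := Real.sq_sqrt (Finset.sum_nonneg fun m _ => sq_nonneg _)
  rcases (show 0 ≤ s from Real.sqrt_nonneg _).eq_or_lt with h0 | hpos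
  · rw [← h0]
    exact mul_nonneg (by norm_num) (integral_nonneg fun g => abs_nonneg _)
  have hscale : ∀ g : κ → ℝ, |∑ m, g m * u m| = s * |∑ m, g m * (u m / s)| := fun g => by
    have : ∑ m, g m * u m = s * ∑ m, g m * (u m / s) := by
      rw [Finset.mul_sum]
      exact Finset.sum_congr rfl fun m _ => by field_simp
    rw [this, abs_mul, abs_of_pos hpos]
  have hcos := integral_cos_sum_gaussPi fun m => u m / s
  have hone : ∑ m, (u m / s) ^ 2 = 1 := by
    simp_rw [div_pow]
    rw [← Finset.sum_div, ← hs2, div_self (by positivity)]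
  rw [hone] at hcos
  have hexp : Real.exp (-1 / 2) ≤ 2 / 3 := by
    have h1 : (3 / 2 : ℝ) ≤ Real.exp (1 / 2) := by
      have := Real.add_one_le_exp (1 / 2 : ℝ)
      linarith
    rw [neg_div, Real.exp_neg, inv_le_comm₀ (Real.exp_pos _) (by norm_num)]
    linarith
  have hle : ∀ x : ℝ, 1 - Real.cos x ≤ |x| := fun x => by
    rcases le_total 2 |x| with h | h
    · linarith [Real.neg_one_le_cos x]
    · have h1 := Real.one_sub_sq_div_two_le_cos (x := x)
      have h2 : x ^ 2 = |x| * |x| := by rw [← sq, sq_abs]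
      nlinarith [abs_nonneg x]
  have hci : Integrable (fun g : κ → ℝ => Real.cos (∑ m, g m * (u m / s))) (gaussPi κ) :=
    integrable_of_measurable_of_abs_le (by fun_prop) fun g => Real.abs_cos_le_one _
  have hmono : 1 - Real.exp (-1 / 2) ≤ ∫ g, |∑ m, g m * (u m / s)| ∂(gaussPi κ) := by
    rw [← hcos]
    calc 1 - ∫ g, Real.cos (∑ m, g m * (u m / s)) ∂(gaussPi κ)
        = ∫ g, (1 - Real.cos (∑ m, g m * (u m / s))) ∂(gaussPi κ) := by
          rw [integral_sub (integrable_const _) hci]; simp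
      _ ≤ _ := integral_mono ((integrable_const _).sub hci)
          (integrable_sum_mul_gaussPi fun m => u m / s).abs fun g => hle _
  simp_rw [hscale]
  rw [integral_const_mul]
  nlinarith


lemma abs_affine_le {Q : Type*} {A : Q → ℝ} {C : ℝ} (hA : ∀ q, |A q| ≤ C) {v : Q → κ → ℝ} {V : ℝ}
    (hv : ∀ q m, |v q m| ≤ V) (g : κ → ℝ) (q : Q) :
    |A q + 3 * ∑ m, g m * v q m| ≤ C + 3 * V * ∑ m, |g m| := by
  have h1 : |∑ m, g m * v q m| ≤ ∑ m, |g m| * V := abs_sum_le_sum_of_abs_le fun m => by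
    rw [abs_mul]; exact mul_le_mul_of_nonneg_left (hv q m) (abs_nonneg _)
  rw [← Finset.sum_mul] at h1
  calc _ ≤ |A q| + |3 * ∑ m, g m * v q m| := abs_add_le _ _
    _ ≤ C + 3 * ((∑ m, |g m|) * V) := by
      rw [abs_mul, abs_of_pos (by norm_num : (0 : ℝ) < 3)]
      gcongr
      exact hA q
    _ = _ := by ring

variable {Q : Type*} [Countable Q] [Nonempty Q]

lemma integrable_iSup_affine_gaussPi {A : Q → ℝ} {C : ℝ} (hA : ∀ q, |A q| ≤ C)
    {v : Q → κ → ℝ} {V : ℝ} (hv : ∀ q m, |v q m| ≤ V) :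
    Integrable (fun g : κ → ℝ => ⨆ q, (A q + 3 * ∑ m, g m * v q m)) (gaussPi κ) := by
  have henv : Integrable (fun g : κ → ℝ => C + 3 * V * ∑ m, |g m|) (gaussPi κ) :=
    (integrable_const _).add
      ((integrable_finsetSum _ fun m _ => (integrable_eval_gaussPi m).abs).const_mul _)
  refine henv.mono' (Measurable.iSup fun q => by fun_prop).aestronglyMeasurable
    (Filter.Eventually.of_forall fun g => ?_)
  exact abs_ciSup_le (abs_affine_le hA hv g)

/-- One step of the contraction: a single random sign in front of a function `φ` is dominated by a
Gaussian linear form in a vector-valued function `v` whose increments dominate those of `φ`. -/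
lemma iSup_add_iSup_le_gaussian {A φ : Q → ℝ} {C : ℝ} (hA : ∀ q, |A q| ≤ C)
    {v : Q → κ → ℝ} {V : ℝ} (hv : ∀ q m, |v q m| ≤ V)
    (hφv : ∀ q q', |φ q - φ q'| ≤ √(∑ m, (v q m - v q' m) ^ 2)) :
    (⨆ q, (A q + φ q)) + (⨆ q, (A q - φ q))
      ≤ 2 * ∫ g, (⨆ q, (A q + 3 * ∑ m, g m * v q m)) ∂(gaussPi κ) := by
  let M : (κ → ℝ) → ℝ := fun g => ⨆ q, (A q + 3 * ∑ m, g m * v q m)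
  have hMi : Integrable M (gaussPi κ) := integrable_iSup_affine_gaussPi hA hv
  have hMle : ∀ g q, A q + 3 * ∑ m, g m * v q m ≤ M g := fun g q =>
    le_ciSup (bddAbove_range_of_abs_le (abs_affine_le hA hv g)) q
  have hneg : MeasurePreserving (fun (g : κ → ℝ) m => -g m) (gaussPi κ) (gaussPi κ) :=
    measurePreserving_pi _ _ fun _ => ⟨measurable_neg, by
      simpa using gaussianReal_map_neg (μ := 0) (v := 1)⟩
  have hMi' : Integrable (fun g : κ → ℝ => M fun m => -g m) (gaussPi κ) :=
    hneg.integrable_comp_of_integrable hMi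
  have hMneg : ∫ g, M (fun m => -g m) ∂(gaussPi κ) = ∫ g, M g ∂(gaussPi κ) := by
    conv_rhs => rw [← hneg.map_eq]
    rw [integral_map hneg.aemeasurable (by rw [hneg.map_eq]; exact hMi.aestronglyMeasurable)]
  have key : ∀ q q', (A q + φ q) + (A q' - φ q') ≤ 2 * ∫ g, M g ∂(gaussPi κ) := by
    intro q q'
    have h1 : φ q - φ q' ≤ 3 * ∫ g, |∑ m, g m * (v q m - v q' m)| ∂(gaussPi κ) :=
      ((le_abs_self _).trans (hφv q q')).trans (sqrt_sum_sq_le_integral_abs _)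
    have hi := (integrable_sum_mul_gaussPi fun m => v q m - v q' m).abs.const_mul 3
    have h2 : A q + A q' + 3 * ∫ g, |∑ m, g m * (v q m - v q' m)| ∂(gaussPi κ)
        = ∫ g, (A q + A q' + 3 * |∑ m, g m * (v q m - v q' m)|) ∂(gaussPi κ) := by
      rw [integral_add (integrable_const _) hi, integral_const_mul]
      simp
    have h3 : ∫ g, (A q + A q' + 3 * |∑ m, g m * (v q m - v q' m)|) ∂(gaussPi κ)
        ≤ ∫ g, (M g + M fun m => -g m) ∂(gaussPi κ) := by
      refine integral_mono ((integrable_const _).add hi) (hMi.add hMi') fun g => ?_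
      have e1 := hMle g q
      have e2 := hMle g q'
      have e3 := hMle (fun m => -g m) q
      have e4 := hMle (fun m => -g m) q'
      simp only [neg_mul, Finset.sum_neg_distrib] at e3 e4
      have e5 : ∑ m, g m * (v q m - v q' m) = ∑ m, g m * v q m - ∑ m, g m * v q' m := by
        simp_rw [mul_sub]
        exact Finset.sum_sub_distrib _ _
      simp only [e5]
      rcases abs_cases (∑ m, g m * v q m - ∑ m, g m * v q' m) with h | h <;> rw [h.1] <;> linarith
    rw [integral_add hMi hMi', hMneg] at h3
    linarith
  have h1 : ∀ q', (⨆ q, (A q + φ q)) ≤ 2 * ∫ g, M g ∂(gaussPi κ) - (A q' - φ q') := fun q' =>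
    ciSup_le fun q => by linarith [key q q']
  have h2 : (⨆ q, (A q - φ q)) ≤ 2 * ∫ g, M g ∂(gaussPi κ) - ⨆ q, (A q + φ q) :=
    ciSup_le fun q' => by linarith [h1 q']
  change _ ≤ 2 * ∫ g, M g ∂(gaussPi κ)
  linarith

lemma sum_bool_fin_succ {n : ℕ} (f : (Fin (n + 1) → Bool) → ℝ) :
    ∑ σ, f σ = ∑ σ : Fin n → Bool, (f (Fin.cons true σ) + f (Fin.cons false σ)) := by
  rw [← (Fin.consEquiv fun _ : Fin (n + 1) => Bool).sum_comp, Fintype.sum_prod_type]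
  simp [Fin.consEquiv, Finset.sum_add_distrib]

lemma integrable_iSup_affine_pi_gaussPi {n : ℕ} {A : Q → ℝ} {C : ℝ} (hA : ∀ q, |A q| ≤ C)
    {v : Fin n → Q → κ → ℝ} {V : ℝ} (hv : ∀ k q m, |v k q m| ≤ V) :
    Integrable (fun g : Fin n → κ → ℝ => ⨆ q, (A q + 3 * ∑ k, ∑ m, g k m * v k q m))
      (Measure.pi fun _ => gaussPi κ) := by
  have hgi : ∀ k m, Integrable (fun g : Fin n → κ → ℝ => g k m)
      (Measure.pi fun _ => gaussPi κ) := fun k m =>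
    integrable_comp_eval (μ := fun _ : Fin n => gaussPi κ) (f := fun x : κ → ℝ => x m)
      (integrable_eval_gaussPi m)
  have henv : Integrable (fun g : Fin n → κ → ℝ => C + 3 * V * ∑ p : Fin n × κ, |g p.1 p.2|)
      (Measure.pi fun _ => gaussPi κ) :=
    (integrable_const _).add
      ((integrable_finsetSum _ fun p _ => (hgi p.1 p.2).abs).const_mul _)
  refine henv.mono' (Measurable.iSup fun q => by fun_prop).aestronglyMeasurable
    (Filter.Eventually.of_forall fun g => abs_ciSup_le fun q => ?_)
  have := abs_affine_le hA (v := fun q (p : Fin n × κ) => v p.1 q p.2)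
    (fun q p => hv p.1 q p.2) (fun p => g p.1 p.2) q
  rwa [Fintype.sum_prod_type] at this

/-- The contraction principle for `n` signs: they are replaced by Gaussian vectors one after the
other, conditionally on the remaining variables. -/
lemma sum_iSup_le_gaussian_fin (n : ℕ) {A : Q → ℝ} {C : ℝ} (hA : ∀ q, |A q| ≤ C)
    {φ : Fin n → Q → ℝ} {b : Fin n → ℝ} (hφ : ∀ k q, |φ k q| ≤ b k)
    {v : Fin n → Q → κ → ℝ} {V : ℝ} (hv : ∀ k q m, |v k q m| ≤ V)
    (hφv : ∀ k q q', |φ k q - φ k q'| ≤ √(∑ m, (v k q m - v k q' m) ^ 2)) :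
    ∑ σ : Fin n → Bool, ⨆ q, (A q + ∑ k, boolSign (σ k) * φ k q)
      ≤ 2 ^ n * ∫ g : Fin n → κ → ℝ, (⨆ q, (A q + 3 * ∑ k, ∑ m, g k m * v k q m))
          ∂(Measure.pi fun _ => gaussPi κ) := by
  induction n generalizing A C with
  | zero => simp
  | succ n ih =>
    rw [sum_bool_fin_succ]
    have hAσ : ∀ (σ : Fin n → Bool) q,
        |A q + ∑ k : Fin n, boolSign (σ k) * φ k.succ q| ≤ C + ∑ k : Fin n, b k.succ :=
      fun σ q => (abs_add_le _ _).trans (add_le_add (hA q)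
        (abs_sum_boolSign_mul_le (fun k => hφ k.succ q) σ))
    have hstep : ∀ σ : Fin n → Bool,
        (⨆ q, (A q + ∑ k, boolSign ((Fin.cons true σ : Fin (n + 1) → Bool) k) * φ k q))
          + (⨆ q, (A q + ∑ k, boolSign ((Fin.cons false σ : Fin (n + 1) → Bool) k) * φ k q))
        ≤ 2 * ∫ g, (⨆ q, ((A q + ∑ k : Fin n, boolSign (σ k) * φ k.succ q)
            + 3 * ∑ m, g m * v 0 q m)) ∂(gaussPi κ) := by
      intro σ
      refine le_trans (le_of_eq ?_) (iSup_add_iSup_le_gaussian (hAσ σ) (hv 0) (hφv 0))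
      congr 1 <;> refine iSup_congr fun q => ?_ <;>
        rw [Fin.sum_univ_succ] <;> simp [boolSign] <;> ring
    refine (Finset.sum_le_sum fun σ _ => hstep σ).trans ?_
    have hσi : ∀ σ : Fin n → Bool, Integrable (fun g : κ → ℝ =>
        ⨆ q, ((A q + ∑ k : Fin n, boolSign (σ k) * φ k.succ q) + 3 * ∑ m, g m * v 0 q m))
        (gaussPi κ) := fun σ => integrable_iSup_affine_gaussPi (hAσ σ) (hv 0)
    rw [← Finset.mul_sum, ← integral_finsetSum _ fun σ _ => hσi σ]
    have hGi := integrable_iSup_affine_pi_gaussPi hA hv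
    have hfub := integral_pi_fin_succ (gaussPi κ) hGi
    have hcons : ∀ (x : κ → ℝ) (y : Fin n → κ → ℝ) q,
        A q + 3 * ∑ k, ∑ m, (Fin.cons x y : Fin (n + 1) → κ → ℝ) k m * v k q m
          = (A q + 3 * ∑ m, x m * v 0 q m) + 3 * ∑ k : Fin n, ∑ m, y k m * v k.succ q m := by
      intro x y q
      rw [Fin.sum_univ_succ]
      simp only [Fin.cons_zero, Fin.cons_succ]
      ring
    simp_rw [hcons] at hfub
    rw [hfub, pow_succ', mul_assoc]
    refine mul_le_mul_of_nonneg_left ?_ (by norm_num)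
    rw [← integral_const_mul]
    refine integral_mono (integrable_finsetSum _ fun σ _ => hσi σ) ?_ fun g => ?_
    · refine Integrable.const_mul ?_ _
      have hmp := (measurePreserving_piFinSuccAbove (fun _ : Fin (n + 1) => gaussPi κ) 0).symm
      have hG' := ((hmp.integrable_comp_emb
        (MeasurableEquiv.measurableEmbedding _)).2 hGi).integral_prod_left
      simpa [MeasurableEquiv.piFinSuccAbove, Fin.insertNthEquiv, hcons] using hG'
    · have := ih (abs_affine_le hA (hv 0) g) (fun k q => hφ k.succ q) (fun k q m => hv k.succ q m)
        (fun k q q' => hφv k.succ q q')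
      refine le_trans (le_of_eq ?_) this
      refine Finset.sum_congr rfl fun σ _ => iSup_congr fun q => ?_
      ring

/-- **Vector contraction**: the Rademacher average of the functions `φ k` is at most three times
the Gaussian average of vector-valued functions `v k` whose increments dominate those
of `φ k`. -/
theorem radAvg_le_gaussian {ι : Type*} [Fintype ι] [DecidableEq ι] {φ : ι → Q → ℝ} {b : ι → ℝ}
    (hφ : ∀ k q, |φ k q| ≤ b k) {v : ι → Q → κ → ℝ} {V : ℝ} (hv : ∀ k q m, |v k q m| ≤ V)
    (hφv : ∀ k q q', |φ k q - φ k q'| ≤ √(∑ m, (v k q m - v k q' m) ^ 2)) :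
    radAvg φ ≤ 3 * ∫ g : ι × κ → ℝ, (⨆ q, ∑ k, ∑ m, g (k, m) * v k q m) ∂(gaussPi (ι × κ)) := by
  let e := Fintype.equivFin ι
  have h := sum_iSup_le_gaussian_fin (Fintype.card ι) (A := fun _ : Q => (0 : ℝ)) (C := 0)
    (fun q => by simp) (φ := fun j => φ (e.symm j)) (fun j q => hφ _ q)
    (v := fun j => v (e.symm j)) (fun j q m => hv _ q m) (fun j q q' => hφv _ q q')
  simp only [zero_add] at h
  have hT : MeasurePreserving (fun (g : Fin (Fintype.card ι) → κ → ℝ) (p : ι × κ) => g (e p.1) p.2)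
      (Measure.pi fun _ => gaussPi κ) (gaussPi (ι × κ)) := by
    have hm : Measurable fun (g : Fin (Fintype.card ι) → κ → ℝ) (p : ι × κ) => g (e p.1) p.2 := by
      fun_prop
    refine ⟨hm, (Measure.pi_eq fun s hs => ?_).symm⟩
    rw [Measure.map_apply hm (MeasurableSet.univ_pi hs)]
    have hpre : (fun (g : Fin (Fintype.card ι) → κ → ℝ) (p : ι × κ) => g (e p.1) p.2) ⁻¹'
        (Set.univ.pi s) = Set.univ.pi fun j => Set.univ.pi fun m => s (e.symm j, m) := by
      ext g
      simp only [Set.mem_preimage, Set.mem_pi, Set.mem_univ, true_imp_iff, Prod.forall]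
      exact ⟨fun hg j m => by simpa using hg (e.symm j) m, fun hg k m => by simpa using hg (e k) m⟩
    rw [hpre, Measure.pi_pi, Fintype.prod_prod_type, ← e.symm.prod_comp]
    simp [gaussPi, Measure.pi_pi]
  have hσ : ∑ σ : Fin (Fintype.card ι) → Bool, ⨆ q, ∑ j, boolSign (σ j) * φ (e.symm j) q
      = ∑ σ : ι → Bool, ⨆ q, ∑ k, boolSign (σ k) * φ k q := by
    rw [← (e.arrowCongr (Equiv.refl Bool)).sum_comp]
    refine Finset.sum_congr rfl fun σ _ => iSup_congr fun q => ?_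
    rw [← e.symm.sum_comp]
    simp
  have hm : Measurable fun g : ι × κ → ℝ => ⨆ q, ∑ k, ∑ m, g (k, m) * v k q m :=
    Measurable.iSup fun q => by fun_prop
  have hint : ∫ g : ι × κ → ℝ, (⨆ q, ∑ k, ∑ m, g (k, m) * v k q m) ∂(gaussPi (ι × κ))
      = ∫ g : Fin (Fintype.card ι) → κ → ℝ, (⨆ q, ∑ j, ∑ m, g j m * v (e.symm j) q m)
          ∂(Measure.pi fun _ => gaussPi κ) := by
    rw [← hT.map_eq, integral_map hT.aemeasurable hm.aestronglyMeasurable]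
    congr 1
    ext g
    refine iSup_congr fun q => ?_
    rw [← e.symm.sum_comp]
    simp
  rw [hσ] at h
  rw [radAvg, inv_mul_le_iff₀ (by positivity), hint]
  refine h.trans (le_of_eq ?_)
  simp_rw [← Real.mul_iSup_of_nonneg (by norm_num : (0 : ℝ) ≤ 3)]
  rw [integral_const_mul]

end HWnet

/-! ### The weighted denoising problem -/

namespace HWnet

variable {M : ℕ}

lemma norm_sq_eq_sum (x : Img M) : ‖x‖ ^ 2 = ∑ m, x m ^ 2 := by
  simp [EuclideanSpace.norm_sq_eq]

lemma abs_apply_le_norm (x : Img M) (m : Fin M) : |x m| ≤ ‖x‖ := by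
  simpa using PiLp.norm_apply_le x m

lemma norm_le_mul_of_abs_le {a b : Img M} {K : ℝ} (hK : 0 ≤ K) (h : ∀ m, |a m| ≤ K * |b m|) :
    ‖a‖ ≤ K * ‖b‖ := by
  refine abs_le_of_sq_le_sq' ?_ (by positivity) |>.2
  rw [mul_pow, norm_sq_eq_sum, norm_sq_eq_sum, Finset.mul_sum]
  refine Finset.sum_le_sum fun m _ => ?_
  have := mul_self_le_mul_self (abs_nonneg _) (h m)
  rw [← sq_abs (a m), ← sq_abs (b m)]
  nlinarith

/-- The data term `½ ‖W ⊙ (Y - X)‖²` of the objective. -/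
noncomputable def dataTerm (W Y X : Img M) : ℝ := (1 / 2 : ℝ) * ∑ m, (W m * (Y m - X m)) ^ 2

/-- The negative gradient `W² ⊙ (Y - X)` of the data term with respect to `X`. -/
noncomputable def residual (W Y X : Img M) : Img M := WithLp.toLp 2 fun m => W m ^ 2 * (Y m - X m)

lemma residual_apply (W Y X : Img M) (m : Fin M) : residual W Y X m = W m ^ 2 * (Y m - X m) := rfl

lemma continuous_dataTerm (W Y : Img M) : Continuous (dataTerm W Y) := by
  unfold dataTerm
  fun_prop

lemma continuous_residual (X : Img M) :
    Continuous fun p : Img M × Img M => residual p.1 p.2 X := by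
  unfold residual
  fun_prop

section Objective

variable {lam : ℝ} {R : Img M → EReal} {W Y X : Img M}

lemma objective_eq_coe {r : ℝ} (hr : R X = r) :
    objective lam R W Y X = ((dataTerm W Y X + lam * r : ℝ) : EReal) := by
  rw [objective, hr, dataTerm]
  push_cast
  rfl

lemma objective_eq_top (hlam : 0 < lam) (hX : R X = ⊤) : objective lam R W Y X = ⊤ := by
  rw [objective, hX, EReal.coe_mul_top_of_pos hlam]
  exact EReal.coe_add_top _

lemma IsProperClosedConvex.coe_toReal (hR : IsProperClosedConvex R) (hX : R X ≠ ⊤) :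
    ((R X).toReal : EReal) = R X :=
  EReal.coe_toReal hX (hR.ne_bot X)

lemma IsProperClosedConvex.apply_lineMap_le (hR : IsProperClosedConvex R) {X' : Img M} {r r' : ℝ}
    (hX : R X ≤ r) (hX' : R X' ≤ r') {s : ℝ} (hs0 : 0 ≤ s) (hs1 : s ≤ 1) :
    R ((1 - s) • X + s • X') ≤ (((1 - s) * r + s * r' : ℝ) : EReal) := by
  have := hR.convex (show (X, r) ∈ {p : Img M × ℝ | R p.1 ≤ (p.2 : EReal)} from hX)
    (show (X', r') ∈ {p : Img M × ℝ | R p.1 ≤ (p.2 : EReal)} from hX')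
    (sub_nonneg.2 hs1) hs0 (by ring)
  simpa using this

/-- Minimality expressed by real numbers: the objective is minimized over the epigraph of `R`. -/
lemma isDenoised_iff (hlam : 0 < lam) (hR : IsProperClosedConvex R) :
    IsDenoised lam R W Y X ↔ R X ≠ ⊤ ∧ ∀ X' (r' : ℝ), R X' ≤ r' →
      dataTerm W Y X + lam * (R X).toReal ≤ dataTerm W Y X' + lam * r' := by
  constructor
  · intro h
    have hX : R X ≠ ⊤ := fun hX => by
      obtain ⟨X₀, hX₀⟩ := hR.exists_ne_top
      have := h X₀
      rw [objective_eq_top hlam hX, objective_eq_coe (hR.coe_toReal hX₀).symm] at this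
      exact EReal.coe_ne_top _ (top_le_iff.1 this)
    refine ⟨hX, fun X' r' hr' => ?_⟩
    have hX' : R X' ≠ ⊤ := fun hX' => by
      rw [hX'] at hr'
      exact EReal.coe_ne_top _ (top_le_iff.1 hr')
    have h1 := h X'
    rw [objective_eq_coe (hR.coe_toReal hX).symm, objective_eq_coe (hR.coe_toReal hX').symm,
      EReal.coe_le_coe_iff] at h1
    rw [← hR.coe_toReal hX', EReal.coe_le_coe_iff] at hr'
    have := mul_le_mul_of_nonneg_left hr' hlam.le
    linarith
  · rintro ⟨hX, h⟩ X'
    by_cases hX' : R X' = ⊤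
    · rw [objective_eq_top hlam hX']
      exact le_top
    · rw [objective_eq_coe (hR.coe_toReal hX).symm, objective_eq_coe (hR.coe_toReal hX').symm,
        EReal.coe_le_coe_iff]
      exact h X' _ (hR.coe_toReal hX').ge

/-- First-order optimality: the residual, divided by `lam`, is a subgradient of `R` at a
minimizer. -/
lemma IsDenoised.sum_residual_mul_le (hlam : 0 < lam) (hR : IsProperClosedConvex R)
    (h : IsDenoised lam R W Y X) {X' : Img M} {r' : ℝ} (hr' : R X' ≤ r') :
    ∑ m, residual W Y X m * (X' m - X m) ≤ lam * r' - lam * (R X).toReal := by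
  obtain ⟨hX, hmin⟩ := (isDenoised_iff hlam hR).1 h
  set r := (R X).toReal
  set a := ∑ m, residual W Y X m * (X' m - X m) with ha
  set b := ∑ m, (W m * (X' m - X m)) ^ 2 with hb
  have hexpand : ∀ s : ℝ, dataTerm W Y ((1 - s) • X + s • X')
      = dataTerm W Y X - s * a + s ^ 2 / 2 * b := fun s => by
    simp only [dataTerm, ha, hb, residual_apply, Finset.mul_sum]
    rw [← Finset.sum_sub_distrib, ← Finset.sum_add_distrib]
    refine Finset.sum_congr rfl fun m _ => ?_
    simp only [PiLp.add_apply, PiLp.smul_apply, smul_eq_mul]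
    ring
  have hs : ∀ s : ℝ, 0 < s → s ≤ 1 → a - (lam * r' - lam * r) ≤ s * (b / 2) := by
    intro s hs0 hs1
    have h1 := hmin _ _ (hR.apply_lineMap_le (hR.coe_toReal hX).ge hr' hs0.le hs1)
    rw [hexpand] at h1
    have : s * (a - (lam * r' - lam * r)) ≤ s * (s * (b / 2)) := by nlinarith
    exact le_of_mul_le_mul_left this hs0
  -- let `s` tend to zero
  have hlim : Filter.Tendsto (fun s : ℝ => s * (b / 2)) (nhdsWithin 0 (Set.Ioi 0)) (nhds 0) := by
    have : Filter.Tendsto (fun s : ℝ => s * (b / 2)) (nhds 0) (nhds (0 * (b / 2))) :=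
      (continuous_id.mul continuous_const).tendsto 0
    rw [zero_mul] at this
    exact this.mono_left nhdsWithin_le_nhds
  have := ge_of_tendsto hlim (b := a - (lam * r' - lam * r)) (by
    filter_upwards [Ioc_mem_nhdsGT (zero_lt_one (α := ℝ))] with s hs' using hs s hs'.1 hs'.2)
  linarith

/-- The subdifferential of `R` is monotone, which yields the stability estimate behind uniqueness,
continuity and Lipschitz continuity of the solution map. -/
lemma IsDenoised.norm_sub_le (hlam : 0 < lam) (hR : IsProperClosedConvex R) {ε : ℝ} (hε : 0 < ε)
    {W₁ W₂ Y₁ Y₂ X₁ X₂ : Img M} (hW₁ : ∀ m, ε ≤ W₁ m) (h₁ : IsDenoised lam R W₁ Y₁ X₁)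
    (h₂ : IsDenoised lam R W₂ Y₂ X₂) :
    ε ^ 2 * ‖X₁ - X₂‖ ≤ ‖residual W₁ Y₁ X₂ - residual W₂ Y₂ X₂‖ := by
  have hX₁ := ((isDenoised_iff hlam hR).1 h₁).1
  have hX₂ := ((isDenoised_iff hlam hR).1 h₂).1
  have e1 := h₁.sum_residual_mul_le hlam hR (hR.coe_toReal hX₂).ge
  have e2 := h₂.sum_residual_mul_le hlam hR (hR.coe_toReal hX₁).ge
  set u := residual W₁ Y₁ X₂ - residual W₂ Y₂ X₂ with hu
  have e3 : ∑ m, residual W₁ Y₁ X₁ m * (X₂ m - X₁ m) + ∑ m, residual W₂ Y₂ X₂ m * (X₁ m - X₂ m)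
      = ∑ m, (W₁ m * (X₁ m - X₂ m)) ^ 2 - ∑ m, u m * (X₁ m - X₂ m) := by
    rw [← Finset.sum_add_distrib, ← Finset.sum_sub_distrib]
    refine Finset.sum_congr rfl fun m _ => ?_
    simp only [hu, residual_apply, PiLp.sub_apply]
    ring
  have e4 : ε ^ 2 * ‖X₁ - X₂‖ ^ 2 ≤ ∑ m, (W₁ m * (X₁ m - X₂ m)) ^ 2 := by
    rw [norm_sq_eq_sum, Finset.mul_sum]
    refine Finset.sum_le_sum fun m _ => ?_
    rw [mul_pow, PiLp.sub_apply]
    have := hW₁ m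
    gcongr
  have e5 : ∑ m, u m * (X₁ m - X₂ m) ≤ ‖u‖ * ‖X₁ - X₂‖ := by
    have := real_inner_le_norm u (X₁ - X₂)
    rw [PiLp.inner_apply] at this
    refine le_trans (le_of_eq ?_) this
    refine Finset.sum_congr rfl fun m _ => ?_
    simp [mul_comm]
  rcases (norm_nonneg (X₁ - X₂)).eq_or_lt with h0 | hpos
  · rw [← h0, mul_zero]
    exact norm_nonneg _
  · refine le_of_mul_le_mul_right ?_ hpos
    nlinarith

/-- A proper closed convex function is bounded below by a function with linear growth: it attains
its minimum on the unit ball around a point of its domain, and convexity along rays propagates this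
bound. -/
lemma IsProperClosedConvex.exists_linear_lower_bound (hR : IsProperClosedConvex R) :
    ∃ (X₀ : Img M) (a c : ℝ), R X₀ ≠ ⊤ ∧ 0 ≤ c ∧ ∀ X (r : ℝ), R X ≤ r → a - c * ‖X - X₀‖ ≤ r := by
  obtain ⟨X₀, hX₀⟩ := hR.exists_ne_top
  obtain ⟨X₁, hX₁, hmin⟩ := (hR.closed.lowerSemicontinuousOn _).exists_isMinOn
    (Metric.nonempty_closedBall.2 zero_le_one : (Metric.closedBall X₀ 1).Nonempty)
    (isCompact_closedBall X₀ 1)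
  have h10 : R X₁ ≤ R X₀ := hmin (Metric.mem_closedBall_self zero_le_one)
  have hX₁t : R X₁ ≠ ⊤ := ne_top_of_le_ne_top hX₀ h10
  set r₀ := (R X₀).toReal
  set a := (R X₁).toReal
  have har : a ≤ r₀ := by
    rwa [← hR.coe_toReal hX₀, ← hR.coe_toReal hX₁t, EReal.coe_le_coe_iff] at h10
  have hball : ∀ X (r : ℝ), ‖X - X₀‖ ≤ 1 → R X ≤ r → a ≤ r := fun X r hX hr => by
    have h1 : R X₁ ≤ R X := hmin (by rwa [Metric.mem_closedBall, dist_eq_norm])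
    have := h1.trans hr
    rwa [← hR.coe_toReal hX₁t, EReal.coe_le_coe_iff] at this
  refine ⟨X₀, a, r₀ - a, hX₀, sub_nonneg.2 har, fun X r hr => ?_⟩
  rcases le_total ‖X - X₀‖ 1 with h1 | h1
  · have := hball X r h1 hr
    have := mul_nonneg (sub_nonneg.2 har) (norm_nonneg (X - X₀))
    linarith
  · set n := ‖X - X₀‖ with hn
    have hnpos : 0 < n := by linarith
    have hs1 : n⁻¹ ≤ 1 := inv_le_one_of_one_le₀ h1
    have h2 := hR.apply_lineMap_le (hR.coe_toReal hX₀).ge hr (inv_nonneg.2 hnpos.le) hs1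
    have h3 : ‖(1 - n⁻¹) • X₀ + n⁻¹ • X - X₀‖ ≤ 1 := by
      have : (1 - n⁻¹) • X₀ + n⁻¹ • X - X₀ = n⁻¹ • (X - X₀) := by module
      rw [this, norm_smul, ← hn, Real.norm_of_nonneg (inv_nonneg.2 hnpos.le),
        inv_mul_cancel₀ hnpos.ne']
    have h4 := hball _ _ h3 h2
    have h5 : n * a ≤ n * ((1 - n⁻¹) * r₀ + n⁻¹ * r) := mul_le_mul_of_nonneg_left h4 hnpos.le
    have h6 : n * ((1 - n⁻¹) * r₀ + n⁻¹ * r) = (n - 1) * r₀ + r := by field_simp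
    rw [h6] at h5
    linarith

/-- Existence of the restored image: the data term grows quadratically and `R` decreases at most
linearly, so that the objective can be minimized over a compact part of the epigraph of `R`. -/
lemma exists_isDenoised (hlam : 0 < lam) (hR : IsProperClosedConvex R) {ε : ℝ} (hε : 0 < ε)
    (hW : ∀ m, ε ≤ W m) : ∃ X, IsDenoised lam R W Y X := by
  obtain ⟨X₀, a, c, hX₀, hc, hlow⟩ := hR.exists_linear_lower_bound
  set r₀ := (R X₀).toReal
  set J : Img M × ℝ → ℝ := fun p => dataTerm W Y p.1 + lam * p.2 with hJ
  have hJc : Continuous J :=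
    ((continuous_dataTerm W Y).comp continuous_fst).add (continuous_snd.const_mul lam)
  have hdata : ∀ X, ε ^ 2 / 2 * ‖Y - X‖ ^ 2 ≤ dataTerm W Y X := fun X => by
    rw [norm_sq_eq_sum, dataTerm, Finset.mul_sum, Finset.mul_sum]
    refine Finset.sum_le_sum fun m _ => ?_
    have h1 : ε ^ 2 ≤ W m ^ 2 := pow_le_pow_left₀ hε.le (hW m) 2
    have h2 := mul_le_mul_of_nonneg_right h1 (sq_nonneg (Y m - X m))
    rw [mul_pow, PiLp.sub_apply]
    linarith
  set d := ‖Y - X₀‖ with hd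
  set k := J (X₀, r₀) - lam * a + lam * c * d with hk
  set ρ := 2 / ε ^ 2 * (lam * c + |k|) + 1 with hρ
  have hlc : 0 ≤ lam * c := mul_nonneg hlam.le hc
  have hρ1 : 1 ≤ ρ := by
    have : 0 ≤ 2 / ε ^ 2 * (lam * c + |k|) := by positivity
    linarith
  have hd0 : 0 ≤ d := norm_nonneg _
  -- points of the epigraph far away from `X₀` have a larger objective than `X₀`
  have hfar : ∀ X (r : ℝ), R X ≤ r → J (X, r) ≤ J (X₀, r₀) → ‖X - X₀‖ ≤ d + ρ := by
    intro X r hr hle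
    by_contra! hgt
    set u := ‖X - X₀‖ - d with hu
    have huρ : ρ < u := by linarith
    have h1 : u ≤ ‖Y - X‖ := by
      have : ‖X - X₀‖ ≤ ‖Y - X‖ + ‖Y - X₀‖ := by
        rw [norm_sub_rev Y X, show X - X₀ = (X - Y) + (Y - X₀) by abel]
        exact norm_add_le _ _
      linarith
    have h2 : ε ^ 2 / 2 * u ^ 2 ≤ dataTerm W Y X :=
      le_trans (by gcongr; linarith) (hdata X)
    have h3 := mul_le_mul_of_nonneg_left (hlow X r hr) hlam.le
    have h4 : ε ^ 2 / 2 * u ^ 2 - lam * c * u ≤ k := by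
      have : dataTerm W Y X + lam * r ≤ J (X₀, r₀) := hle
      have h5 : ‖X - X₀‖ = u + d := by rw [hu]; ring
      rw [h5] at h3
      rw [hk]
      linarith
    have h6 : lam * c + |k| < ε ^ 2 / 2 * u := by
      have : 2 / ε ^ 2 * (lam * c + |k|) < u := by linarith
      rw [div_mul_eq_mul_div, div_lt_iff₀ (by positivity)] at this
      linarith
    have hu1 : 1 < u := by linarith
    have h7 : u * (lam * c + |k|) < u * (ε ^ 2 / 2 * u) :=
      mul_lt_mul_of_pos_left h6 (by linarith)
    have h8 : |k| ≤ u * |k| := le_mul_of_one_le_left (abs_nonneg k) hu1.le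
    have h9 := le_abs_self k
    nlinarith
  have hepi : IsClosed {p : Img M × ℝ | R p.1 ≤ (p.2 : EReal)} :=
    hR.closed.isClosed_epigraph.preimage
      (continuous_fst.prodMk (continuous_coe_real_ereal.comp continuous_snd))
  set S : Set (Img M × ℝ) := {p | R p.1 ≤ (p.2 : EReal)} ∩ {p | J p ≤ J (X₀, r₀)} with hS
  have hScl : IsClosed S := hepi.inter (isClosed_le hJc continuous_const)
  have hmem : (X₀, r₀) ∈ S := ⟨(hR.coe_toReal hX₀).ge, le_refl (J (X₀, r₀))⟩
  have hSc : IsCompact S := by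
    refine ((isCompact_closedBall X₀ (d + ρ)).prod
      (isCompact_Icc (a := a - c * (d + ρ)) (b := J (X₀, r₀) / lam))).of_isClosed_subset hScl ?_
    rintro ⟨X, r⟩ ⟨hr, hle⟩
    have h1 := hfar X r hr hle
    refine ⟨by rwa [Metric.mem_closedBall, dist_eq_norm], ?_, ?_⟩
    · have h2 := hlow X r hr
      have h3 := mul_le_mul_of_nonneg_left h1 hc
      simp only
      linarith
    · rw [le_div_iff₀ hlam]
      have h2 : dataTerm W Y X + lam * r ≤ J (X₀, r₀) := hle
      have h3 : 0 ≤ dataTerm W Y X := le_trans (by positivity) (hdata X)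
      simp only
      linarith
  obtain ⟨⟨X, r⟩, ⟨hXr, hJX⟩, hmin⟩ := hSc.exists_isMinOn ⟨_, hmem⟩ hJc.continuousOn
  have hXr' : R X ≤ (r : EReal) := hXr
  have hXt : R X ≠ ⊤ := ne_top_of_le_ne_top (EReal.coe_ne_top r) hXr'
  refine ⟨X, (isDenoised_iff hlam hR).2 ⟨hXt, fun X' r' hr' => ?_⟩⟩
  have h1 : (R X).toReal ≤ r := by
    rwa [← hR.coe_toReal hXt, EReal.coe_le_coe_iff] at hXr'
  have h2 := mul_le_mul_of_nonneg_left h1 hlam.le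
  have h3 : J (X, r) ≤ J (X', r') := by
    rcases le_total (J (X', r')) (J (X₀, r₀)) with h | h
    · exact hmin (show (X', r') ∈ S from ⟨hr', h⟩)
    · exact le_trans hJX h
  simp only [hJ] at h3
  linarith

lemma isDenoised_denoise (hlam : 0 < lam) (hR : IsProperClosedConvex R) {ε : ℝ} (hε : 0 < ε)
    (hW : ∀ m, ε ≤ W m) : IsDenoised lam R W Y (denoise lam R W Y) :=
  Classical.epsilon_spec (exists_isDenoised hlam hR hε hW)

lemma isDenoised_iff_eq_denoise (hlam : 0 < lam) (hR : IsProperClosedConvex R) {ε : ℝ}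
    (hε : 0 < ε) (hW : ∀ m, ε ≤ W m) :
    IsDenoised lam R W Y X ↔ X = denoise lam R W Y := by
  have hd := isDenoised_denoise (Y := Y) hlam hR hε hW
  refine ⟨fun h => ?_, fun h => h ▸ hd⟩
  have := h.norm_sub_le hlam hR hε hW hd
  rw [sub_self, norm_zero] at this
  have h0 : ‖X - denoise lam R W Y‖ ≤ 0 :=
    le_of_mul_le_mul_left (by rwa [mul_zero]) (pow_pos hε 2)
  exact sub_eq_zero.1 (norm_le_zero_iff.1 h0)

end Objective

section SolutionMap

variable {lam : ℝ} {R : Img M → EReal} {ε B : ℝ}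

lemma continuousOn_denoise (hlam : 0 < lam) (hR : IsProperClosedConvex R) (hε : 0 < ε) :
    ContinuousOn (fun p : Img M × Img M => denoise lam R p.1 p.2)
      (weightBox M ε B ×ˢ Set.univ) := by
  rintro ⟨W₀, Y₀⟩ ⟨hW₀, -⟩
  set X₀ := denoise lam R W₀ Y₀
  have h₀ : IsDenoised lam R W₀ Y₀ X₀ := isDenoised_denoise hlam hR hε fun m => (hW₀ m).1
  refine tendsto_iff_norm_sub_tendsto_zero.2 ?_
  have hlim : Filter.Tendsto (fun p : Img M × Img M =>
      (ε ^ 2)⁻¹ * ‖residual p.1 p.2 X₀ - residual W₀ Y₀ X₀‖)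
      (nhdsWithin (W₀, Y₀) (weightBox M ε B ×ˢ Set.univ)) (nhds 0) := by
    have hc : Continuous fun p : Img M × Img M =>
        (ε ^ 2)⁻¹ * ‖residual p.1 p.2 X₀ - residual W₀ Y₀ X₀‖ :=
      ((continuous_residual X₀).sub continuous_const).norm.const_mul _
    have := hc.tendsto (W₀, Y₀)
    simp only [sub_self, norm_zero, mul_zero] at this
    exact this.mono_left nhdsWithin_le_nhds
  refine squeeze_zero' (Filter.Eventually.of_forall fun _ => norm_nonneg _) ?_ hlim
  filter_upwards [self_mem_nhdsWithin] with p hp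
  have hp1 : ∀ m, ε ≤ p.1 m := fun m => (hp.1 m).1
  have := (isDenoised_denoise (Y := p.2) hlam hR hε hp1).norm_sub_le hlam hR hε hp1 h₀
  rw [le_inv_mul_iff₀ (pow_pos hε 2)]
  exact this

/-- Entrywise bounded data have entrywise bounded restorations, uniformly in the weight. -/
lemma exists_abs_denoise_le (hlam : 0 < lam) (hR : IsProperClosedConvex R) (hε : 0 < ε) (Bd : ℝ) :
    ∃ C, ∀ Y : Img M, (∀ m, |Y m| ≤ Bd) → ∀ W ∈ weightBox M ε B, ∀ m,
      |denoise lam R W Y m| ≤ C := by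
  by_cases hne : (weightBox M ε B).Nonempty
  swap
  · exact ⟨0, fun Y _ W hW => absurd ⟨W, hW⟩ hne⟩
  obtain ⟨W₀, hW₀⟩ := hne
  set X₀ := denoise lam R W₀ (0 : Img M)
  have h₀ : IsDenoised lam R W₀ 0 X₀ := isDenoised_denoise hlam hR hε fun m => (hW₀ m).1
  set one : Img M := WithLp.toLp 2 fun _ => 1
  set K := B ^ 2 * (|Bd| + ‖X₀‖)
  have hK : 0 ≤ K := by positivity
  refine ⟨(ε ^ 2)⁻¹ * (K * ‖one‖ + ‖residual W₀ 0 X₀‖) + ‖X₀‖, fun Y hY W hW m => ?_⟩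
  have h1 := (isDenoised_denoise (Y := Y) hlam hR hε fun m => (hW m).1).norm_sub_le hlam hR hε
    (fun m => (hW m).1) h₀
  have h2 : ‖residual W Y X₀‖ ≤ K * ‖one‖ := norm_le_mul_of_abs_le hK fun m => by
    rw [residual_apply, abs_mul, abs_of_nonneg (sq_nonneg _)]
    have e1 : W m ^ 2 ≤ B ^ 2 := pow_le_pow_left₀ (hε.le.trans (hW m).1) (hW m).2 2
    have e2 : |Y m - X₀ m| ≤ |Bd| + ‖X₀‖ := (abs_sub _ _).trans
      (add_le_add ((hY m).trans (le_abs_self _)) (abs_apply_le_norm X₀ m))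
    have e3 : |one m| = 1 := by simp [one]
    rw [e3, mul_one]
    exact mul_le_mul e1 e2 (abs_nonneg _) (sq_nonneg _)
  have h3 := norm_sub_le (residual W Y X₀) (residual W₀ 0 X₀)
  have h4 : ‖denoise lam R W Y - X₀‖ ≤ (ε ^ 2)⁻¹ * (K * ‖one‖ + ‖residual W₀ 0 X₀‖) := by
    rw [le_inv_mul_iff₀ (pow_pos hε 2)]
    linarith
  have h5 := norm_sub_norm_le (denoise lam R W Y) X₀
  have h6 := abs_apply_le_norm (denoise lam R W Y) m
  linarith

/-- The solution map is Lipschitz in the weight, with a constant that involves a bound for the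
difference of the noisy and the restored image. -/
lemma norm_denoise_sub_le (hlam : 0 < lam) (hR : IsProperClosedConvex R) (hε : 0 < ε)
    {Y W₁ W₂ : Img M} (hW₁ : W₁ ∈ weightBox M ε B) (hW₂ : W₂ ∈ weightBox M ε B) (hB : 0 ≤ B)
    {C : ℝ} (hC0 : 0 ≤ C) (hC : ∀ m, |Y m - denoise lam R W₂ Y m| ≤ C) :
    ‖denoise lam R W₁ Y - denoise lam R W₂ Y‖ ≤ 2 * B * C / ε ^ 2 * ‖W₁ - W₂‖ := by
  have h := (isDenoised_denoise (Y := Y) hlam hR hε fun m => (hW₁ m).1).norm_sub_le hlam hR hε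
    (fun m => (hW₁ m).1) (isDenoised_denoise (Y := Y) hlam hR hε fun m => (hW₂ m).1)
  set X₂ := denoise lam R W₂ Y
  have h2 : ‖residual W₁ Y X₂ - residual W₂ Y X₂‖ ≤ 2 * B * C * ‖W₁ - W₂‖ := by
    refine norm_le_mul_of_abs_le (by positivity) fun m => ?_
    have e1 : (residual W₁ Y X₂ - residual W₂ Y X₂) m
        = (W₁ m + W₂ m) * (Y m - X₂ m) * (W₁ m - W₂ m) := by
      simp only [PiLp.sub_apply, residual_apply]
      ring
    have e2 : |W₁ m + W₂ m| ≤ 2 * B := by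
      rw [abs_of_nonneg (by linarith [(hW₁ m).1, (hW₂ m).1])]
      linarith [(hW₁ m).2, (hW₂ m).2]
    rw [e1, abs_mul, abs_mul, PiLp.sub_apply]
    gcongr
    exact hC m
  rw [div_mul_eq_mul_div, le_div_iff₀ (pow_pos hε 2), mul_comm]
  exact h.trans h2

end SolutionMap

section LipschitzConstant

variable {T : ℕ} {lam : Fin T → ℝ} {R : Fin T → Img M → EReal} {𝕐 : Set (Img M)} {ε B Bd : ℝ}

lemma mem_lipConstants (hlam : ∀ t, 0 < lam t) (hR : ∀ t, IsProperClosedConvex (R t))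
    (hε : 0 < ε) (hB : 0 ≤ B) {C : ℝ} (hC0 : 0 ≤ C)
    (hC : ∀ t, ∀ Y ∈ 𝕐, ∀ W ∈ weightBox M ε B, ∀ m, |Y m - denoise (lam t) (R t) W Y m| ≤ C) :
    2 * B * C / ε ^ 2 ∈ lipConstants lam R 𝕐 ε B :=
  ⟨by positivity, fun t Y hY _ hW₁ W₂ hW₂ =>
    norm_denoise_sub_le (hlam t) (hR t) hε hW₁ hW₂ hB hC0 (hC t Y hY W₂ hW₂)⟩

lemma lipConstants_nonempty (hlam : ∀ t, 0 < lam t) (hR : ∀ t, IsProperClosedConvex (R t))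
    (hε : 0 < ε) (hB : 0 ≤ B) (h𝕐 : ∀ Y ∈ 𝕐, ∀ m, |Y m| ≤ Bd) :
    (lipConstants lam R 𝕐 ε B).Nonempty := by
  choose C hC using fun t => exists_abs_denoise_le (B := B) (hlam t) (hR t) hε Bd
  refine ⟨_, mem_lipConstants (C := |Bd| + ∑ t, |C t|) hlam hR hε hB (by positivity)
    fun t Y hY W hW m => ?_⟩
  have h1 := hC t Y (h𝕐 Y hY) W hW m
  have h2 : |C t| ≤ ∑ t, |C t| :=
    Finset.single_le_sum (f := fun t => |C t|) (fun _ _ => abs_nonneg _) (Finset.mem_univ t)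
  have h3 := abs_sub (Y m) (denoise (lam t) (R t) W Y m)
  have h4 := h𝕐 Y hY m
  linarith [le_abs_self (C t), le_abs_self Bd]

lemma isLeast_lipConst (hne : (lipConstants lam R 𝕐 ε B).Nonempty) :
    IsLeast (lipConstants lam R 𝕐 ε B) (lipConst lam R 𝕐 ε B) := by
  have hbdd : BddBelow (lipConstants lam R 𝕐 ε B) := ⟨0, fun L hL => hL.1⟩
  refine ⟨⟨le_csInf hne fun L hL => hL.1, fun t Y hY W₁ hW₁ W₂ hW₂ => ?_⟩,
    fun L hL => csInf_le hbdd hL⟩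
  rcases (norm_nonneg (W₁ - W₂)).eq_or_lt with h0 | hpos
  · obtain ⟨L, hL⟩ := hne
    have := hL.2 t Y hY W₁ hW₁ W₂ hW₂
    rw [← h0, mul_zero] at this ⊢
    exact this
  · rw [← div_le_iff₀ hpos]
    refine le_csInf hne fun L hL => ?_
    rw [div_le_iff₀ hpos]
    exact hL.2 t Y hY W₁ hW₁ W₂ hW₂

lemma lipConst_le (hlam : ∀ t, 0 < lam t) (hR : ∀ t, IsProperClosedConvex (R t))
    (hε : 0 < ε) (hB : 0 ≤ B) (hBd : 0 ≤ Bd) (h𝕐 : ∀ Y ∈ 𝕐, ∀ m, |Y m| ≤ Bd)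
    (hX : ∀ t, ∀ Y ∈ 𝕐, ∀ W ∈ weightBox M ε B, ∀ m, |denoise (lam t) (R t) W Y m| ≤ Bd) :
    lipConst lam R 𝕐 ε B ≤ 4 * Bd * B / ε ^ 2 := by
  refine csInf_le ⟨0, fun L hL => hL.1⟩ ?_
  have := mem_lipConstants (𝕐 := 𝕐) (C := 2 * Bd) hlam hR hε hB (by positivity)
    fun t Y hY W hW m => (abs_sub _ _).trans (by linarith [h𝕐 Y hY m, hX t Y hY W hW m])
  convert! this using 2
  ring

end LipschitzConstant

end HWnet

/-! ### The uniform deviation bound with Gaussian averages -/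

namespace HWnet

/-- With probability at least `1 - δ`, the excess of the expected over the empirical mean at any
parameter, plus the fluctuation at a fixed parameter `θ₀`, is bounded by a Gaussian average.
Continuity in the parameter reduces the suprema to a countable dense set of parameters. -/
theorem exists_deviation_le_gaussian {ι κ Θ 𝓩 : Type*} [Fintype ι] [DecidableEq ι] [Fintype κ]
    [TopologicalSpace Θ] [TopologicalSpace.SeparableSpace Θ] [MeasurableSpace 𝓩]
    [FirstCountableTopology Θ] (D : Measure 𝓩) [IsProbabilityMeasure D]
    {Φ : ι → Θ → 𝓩 → ℝ} {b : ι → ℝ}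
    (hΦ : ∀ k θ, Measurable (Φ k θ)) (hΦc : ∀ k z, Continuous fun θ => Φ k θ z)
    (hb : ∀ k θ z, |Φ k θ z| ≤ b k) (θ₀ : Θ) {δ : ℝ} (hδ : 0 < δ) (hδ1 : δ ≤ 1) :
    ∃ A : Set (ι → 𝓩), MeasurableSet A ∧ ENNReal.ofReal (1 - δ) ≤ (Measure.pi fun _ => D) A ∧
      ∀ S ∈ A, ∀ (v : ι → Θ → κ → ℝ) (V : ℝ), (∀ k m, Continuous fun θ => v k θ m) →
        (∀ k θ m, |v k θ m| ≤ V) →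
        (∀ k θ θ', |Φ k θ (S k) - Φ k θ' (S k)| ≤ √(∑ m, (v k θ m - v k θ' m) ^ 2)) →
        ∀ θ, ∑ k, (∫ z, Φ k θ z ∂D - Φ k θ (S k)) + ∑ k, (Φ k θ₀ (S k) - ∫ z, Φ k θ₀ z ∂D)
          ≤ 6 * ∫ g : ι × κ → ℝ, (⨆ θ, ∑ k, ∑ m, g (k, m) * v k θ m) ∂(gaussPi (ι × κ))
            + 6 * √(∑ k, b k ^ 2) * √(Real.log (1 / δ) / 2) := by
  obtain ⟨s, hsc, hsd⟩ := TopologicalSpace.exists_countable_dense Θ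
  set Q : Set Θ := insert θ₀ s
  have hQd : Dense Q := hsd.mono (Set.subset_insert _ _)
  have : Countable Q := (hsc.insert θ₀).to_subtype
  have : Nonempty Q := ⟨⟨θ₀, Set.mem_insert _ _⟩⟩
  obtain ⟨A, hAm, hA, hAS⟩ := measure_iSup_deviation_le D (φ := fun k (q : Q) => Φ k q)
    (fun k q => hΦ k q) (fun k q z => hb k q z) ⟨θ₀, Set.mem_insert _ _⟩ hδ hδ1
  refine ⟨A, hAm, hA, fun S hS v V hvc hv hΦv θ => ?_⟩
  have h := hAS S hS
  have hIc : ∀ k, Continuous fun θ => ∫ z, Φ k θ z ∂D := fun k =>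
    continuous_of_dominated (fun θ => (hΦ k θ).aestronglyMeasurable)
      (fun θ => Filter.Eventually.of_forall fun z => hb k θ z) (integrable_const (b k))
      (Filter.Eventually.of_forall fun z => hΦc k z)
  have hdevc : Continuous fun θ => ∑ k, (∫ z, Φ k θ z ∂D - Φ k θ (S k)) :=
    continuous_finsetSum _ fun k _ => (hIc k).sub (hΦc k (S k))
  have hdevb : ∀ θ, |∑ k, (∫ z, Φ k θ z ∂D - Φ k θ (S k))| ≤ ∑ k, 2 * b k := fun θ =>
    abs_sum_le_sum_of_abs_le fun k => by
      have h1 := abs_sub (∫ z, Φ k θ z ∂D) (Φ k θ (S k))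
      have h2 : |∫ z, Φ k θ z ∂D| ≤ b k := abs_integral_le_of_abs_le (hb k θ)
      linarith [hb k θ (S k)]
  rw [hQd.ciSup' hdevc] at h
  have h1 := le_ciSup (bddAbove_range_of_abs_le hdevb) θ
  have h2 := radAvg_le_gaussian (φ := fun k (q : Q) => Φ k q (S k)) (b := b)
    (fun k q => hb k q (S k)) (v := fun k (q : Q) => v k q) (fun k q m => hv k q m)
    (fun k q q' => hΦv k q q')
  have h3 : ∀ g : ι × κ → ℝ, (⨆ q : Q, ∑ k, ∑ m, g (k, m) * v k q m)
      = ⨆ θ, ∑ k, ∑ m, g (k, m) * v k θ m := fun g =>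
    hQd.ciSup' (f := fun θ => ∑ k, ∑ m, g (k, m) * v k θ m)
      (continuous_finsetSum _ fun k _ => continuous_finsetSum _ fun m _ =>
        (hvc k m).const_mul _)
  simp_rw [h3] at h2
  linarith

end HWnet

/-! ### The loss of the restored images -/

namespace HWnet

variable {M : ℕ}

/-- The projection onto the box of admissible weights, entry by entry. -/
noncomputable def clampBox (ε B : ℝ) (W : Img M) : Img M :=
  WithLp.toLp 2 fun m => max ε (min B (W m))

lemma clampBox_mem {ε B : ℝ} (h : ε ≤ B) (W : Img M) : clampBox ε B W ∈ weightBox M ε B :=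
  fun _ => ⟨le_max_left _ _, max_le h (min_le_left _ _)⟩

lemma clampBox_eq {ε B : ℝ} {W : Img M} (h : W ∈ weightBox M ε B) : clampBox ε B W = W := by
  ext m
  simp [clampBox, (h m).1, (h m).2]

lemma continuous_clampBox (ε B : ℝ) : Continuous (clampBox ε B : Img M → Img M) := by
  unfold clampBox
  fun_prop

/-- A version of the loss of the restored image that is measurable and bounded everywhere: the
weight is projected onto the box of admissible weights, outside of which `denoise` need not be
measurable, and the loss is set to zero outside a set `G` of admissible pairs. -/
noncomputable def truncLoss (lam : ℝ) (R : Img M → EReal) (ε B : ℝ) (G : Set (Img M × Img M))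
    (loss : Img M → Img M → ℝ) (w : Img M → Img M) (z : Img M × Img M) : ℝ :=
  G.indicator (fun z => loss (denoise lam R (clampBox ε B (w z.1)) z.1) z.2) z

section TruncLoss

variable {lam : ℝ} {R : Img M → EReal} {ε B : ℝ} {G : Set (Img M × Img M)}
  {loss : Img M → Img M → ℝ} {w : Img M → Img M}

lemma truncLoss_of_notMem {z : Img M × Img M} (hz : z ∉ G) :
    truncLoss lam R ε B G loss w z = 0 :=
  Set.indicator_of_notMem hz _

lemma truncLoss_of_mem {z : Img M × Img M} (hz : z ∈ G) (hw : w z.1 ∈ weightBox M ε B) :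
    truncLoss lam R ε B G loss w z = loss (denoise lam R (w z.1) z.1) z.2 := by
  rw [truncLoss, Set.indicator_of_mem hz, clampBox_eq hw]

lemma measurable_truncLoss (hlam : 0 < lam) (hR : IsProperClosedConvex R) (hε : 0 < ε)
    (hεB : ε ≤ B) (hG : MeasurableSet G)
    (hloss : Measurable fun z : Img M × Img M => loss z.1 z.2) (hw : Measurable w) :
    Measurable (truncLoss lam R ε B G loss w) := by
  have hf : Continuous fun p : Img M × Img M => (clampBox ε B p.1, p.2) :=
    ((continuous_clampBox ε B).comp continuous_fst).prodMk continuous_snd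
  have hc : Continuous fun p : Img M × Img M => denoise lam R (clampBox ε B p.1) p.2 := by
    have := (continuousOn_denoise (B := B) hlam hR hε).comp_continuous hf
      fun p => ⟨clampBox_mem hεB p.1, Set.mem_univ _⟩
    exact this
  have hm : Measurable fun p : Img M × Img M => denoise lam R (clampBox ε B p.1) p.2 :=
    hc.measurable
  have hw1 : Measurable fun z : Img M × Img M => (w z.1, z.1) :=
    (hw.comp measurable_fst).prodMk measurable_fst
  have h1 : Measurable fun z : Img M × Img M => denoise lam R (clampBox ε B (w z.1)) z.1 := by
    have := hm.comp hw1
    simpa only [Function.comp_def] using this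
  have h2 : Measurable fun z : Img M × Img M =>
      loss (denoise lam R (clampBox ε B (w z.1)) z.1) z.2 :=
    hloss.comp (h1.prodMk measurable_snd)
  exact h2.indicator hG

end TruncLoss

/-- Almost sure membership can be witnessed by a measurable set of full measure. -/
lemma exists_measurableSet_subset_of_ae {Ω : Type*} [MeasurableSpace Ω] {μ : Measure Ω}
    {s : Set Ω} (h : ∀ᵐ x ∂μ, x ∈ s) : ∃ G ⊆ s, MeasurableSet G ∧ ∀ᵐ x ∂μ, x ∈ G := by
  refine ⟨(toMeasurable μ sᶜ)ᶜ, ?_, (measurableSet_toMeasurable _ _).compl, ?_⟩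
  · exact Set.compl_subset_comm.1 (subset_toMeasurable _ _)
  · have h0 : μ sᶜ = 0 := h
    rw [← measure_toMeasurable] at h0
    filter_upwards [compl_mem_ae_iff.2 h0] with x hx using hx

end HWnet

theorem mainTheorem2
    (M T p : ℕ) (hM : 0 < M) (hT : 0 < T)
    (N : Fin T → ℕ) (hN : ∀ t, 0 < N t)
    -- data spaces and the data distribution
    (𝕐 𝕏 : Set (HWnet.Img M)) (Bd : ℝ)
    (h𝕐 : ∀ Y ∈ 𝕐, ∀ m, |Y m| ≤ Bd) (h𝕏 : ∀ X ∈ 𝕏, ∀ m, |X m| ≤ Bd)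
    (D : Measure (HWnet.Img M × HWnet.Img M)) [IsProbabilityMeasure D]
    (hD : ∀ᵐ z ∂D, z.1 ∈ 𝕐 ∧ z.2 ∈ 𝕏)
    -- the regularizers of the source models
    (lam : Fin T → ℝ) (hlam : ∀ t, 0 < lam t)
    (R : Fin T → HWnet.Img M → EReal) (hR : ∀ t, HWnet.IsProperClosedConvex (R t))
    -- the weight networks
    (Θ : Set (EuclideanSpace ℝ (Fin p)))
    (h : EuclideanSpace ℝ (Fin p) → HWnet.Img M → HWnet.Img M)
    (hmeas : ∀ θ ∈ Θ, Measurable (h θ))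
    (hcont : ∀ Y ∈ 𝕐, ContinuousOn (fun θ => h θ Y) Θ)
    (ε BH : ℝ) (hε : 0 < ε)
    (hbox : ∀ θ ∈ Θ, ∀ Y ∈ 𝕐, h θ Y ∈ HWnet.weightBox M ε BH)
    -- the loss, controlled on a set `Z` that contains the restored images
    (Z : Set (HWnet.Img M))
    (hZ : ∀ t, ∀ Y ∈ 𝕐, ∀ W ∈ HWnet.weightBox M ε BH,
      HWnet.denoise (lam t) (R t) W Y ∈ Z)
    (loss : HWnet.Img M → HWnet.Img M → ℝ)
    (hloss : Measurable fun z : HWnet.Img M × HWnet.Img M => loss z.1 z.2)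
    (Bl : ℝ) (hBl : ∀ X' ∈ Z, ∀ X ∈ 𝕏, |loss X' X| ≤ Bl)
    (Ln : ℝ≥0) (hLn : ∀ X ∈ 𝕏, LipschitzOnWith Ln (fun X' => loss X' X) Z)
    -- the empirical and the expected risk minimizers
    (θhat : HWnet.Sample M N → EuclideanSpace ℝ (Fin p))
    (hθhat : ∀ S : HWnet.Sample M N, (∀ k, (S k).1 ∈ 𝕐 ∧ (S k).2 ∈ 𝕏) →
      θhat S ∈ Θ ∧ IsMinOn (fun θ => HWnet.empRisk N lam R loss S (h θ)) Θ (θhat S))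
    (θstar : EuclideanSpace ℝ (Fin p)) (hθstar : θstar ∈ Θ)
    (hθstar_min : IsMinOn (fun θ => HWnet.expRisk D lam R loss (h θ)) Θ θstar) :
    -- the restored images are well defined
    (∀ t, ∀ Y, ∀ W ∈ HWnet.weightBox M ε BH, ∀ X,
      HWnet.IsDenoised (lam t) (R t) W Y X ↔ X = HWnet.denoise (lam t) (R t) W Y) ∧
    -- the Lipschitz constant exists, and is explicit when restored images obey the bound `Bd`
    IsLeast (HWnet.lipConstants lam R 𝕐 ε BH) (HWnet.lipConst lam R 𝕐 ε BH) ∧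
    ((∀ X ∈ Z, ∀ m, |X m| ≤ Bd) → HWnet.lipConst lam R 𝕐 ε BH ≤ 4 * Bd * BH / ε ^ 2) ∧
    -- the bound on the training error
    ∀ δ : ℝ, 0 < δ → ∃ A : Set (HWnet.Sample M N), MeasurableSet A ∧
      ENNReal.ofReal (1 - δ) ≤ HWnet.sampleLaw N D A ∧
      ∀ S ∈ A,
        HWnet.expRisk D lam R loss (h (θhat S)) - HWnet.expRisk D lam R loss (h θstar) ≤
          6 * Ln * HWnet.lipConst lam R 𝕐 ε BH * HWnet.gaussComplexity N Θ h S +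
          6 * Bl / T * √(∑ t, 1 / (N t : ℝ)) * √(Real.log (2 / δ) / 2) := by
  obtain ⟨⟨Y₀, X₀⟩, hY₀, hX₀⟩ := hD.exists
  have hεB : ε ≤ BH := (hbox θstar hθstar Y₀ hY₀ ⟨0, hM⟩).1.trans
    (hbox θstar hθstar Y₀ hY₀ ⟨0, hM⟩).2
  have hB : 0 ≤ BH := hε.le.trans hεB
  have hBd : 0 ≤ Bd := (abs_nonneg _).trans (h𝕐 Y₀ hY₀ ⟨0, hM⟩)
  have hBl0 : 0 ≤ Bl := (abs_nonneg _).trans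
    (hBl _ (hZ ⟨0, hT⟩ Y₀ hY₀ _ (hbox θstar hθstar Y₀ hY₀)) X₀ hX₀)
  have hleast : IsLeast (HWnet.lipConstants lam R 𝕐 ε BH) (HWnet.lipConst lam R 𝕐 ε BH) :=
    HWnet.isLeast_lipConst (HWnet.lipConstants_nonempty hlam hR hε hB h𝕐)
  refine ⟨fun t Y W hW X => HWnet.isDenoised_iff_eq_denoise (hlam t) (hR t) hε fun m => (hW m).1,
    hleast, fun hZb => HWnet.lipConst_le hlam hR hε hB hBd h𝕐
      fun t Y hY W hW m => hZb _ (hZ t Y hY W hW) m, fun δ hδ => ?_⟩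
  -- for `δ > 1` the claim about the probability is void, and `log (1 / δ)` would be negative
  rcases lt_or_ge 1 δ with hδ1 | hδ1
  · exact ⟨∅, MeasurableSet.empty, by simp [ENNReal.ofReal_of_nonpos (sub_nonpos.2 hδ1.le)],
      fun S hS => absurd hS (Set.notMem_empty S)⟩
  set L := HWnet.lipConst lam R 𝕐 ε BH with hL
  have hLL : (0 : ℝ) ≤ Ln * L := mul_nonneg Ln.2 hleast.1.1
  -- `𝕐` and `𝕏` need not be measurable
  obtain ⟨G, hGsub, hGm, hG⟩ := HWnet.exists_measurableSet_subset_of_ae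
    (s := {z : HWnet.Img M × HWnet.Img M | z.1 ∈ 𝕐 ∧ z.2 ∈ 𝕏}) hD
  have hG' : ∀ z ∈ G, z.1 ∈ 𝕐 ∧ z.2 ∈ 𝕏 := fun z hz => hGsub hz
  have hTpos : (0 : ℝ) < T := by exact_mod_cast hT
  have hNpos : ∀ t, (0 : ℝ) < N t := fun t => by exact_mod_cast hN t
  -- the weighted losses of the training pairs
  let ω : HWnet.PairIdx N → ℝ := fun k => 1 / T * (1 / N k.1)
  have hω : ∀ k, 0 ≤ ω k := fun k => by positivity
  let l : Fin T → Θ → HWnet.Img M × HWnet.Img M → ℝ := fun t θ =>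
    HWnet.truncLoss (lam t) (R t) ε BH G loss (h θ)
  have hl : ∀ t (θ : Θ), ∀ z ∈ G,
      l t θ z = loss (HWnet.denoise (lam t) (R t) (h θ z.1) z.1) z.2 := fun t θ z hz =>
    HWnet.truncLoss_of_mem hz (hbox θ θ.2 _ (hG' z hz).1)
  have hlm : ∀ t θ, Measurable (l t θ) := fun t θ =>
    HWnet.measurable_truncLoss (hlam t) (hR t) hε hεB hGm hloss (hmeas θ θ.2)
  have hlb : ∀ t θ z, |l t θ z| ≤ Bl := fun t θ z => by
    by_cases hz : z ∈ G
    · rw [hl t θ z hz]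
      exact hBl _ (hZ t _ (hG' z hz).1 _ (hbox θ θ.2 _ (hG' z hz).1)) _ (hG' z hz).2
    · simpa [l, HWnet.truncLoss_of_notMem hz] using hBl0
  have hlLip : ∀ t (θ θ' : Θ), ∀ z ∈ G, |l t θ z - l t θ' z| ≤ Ln * L * ‖h θ z.1 - h θ' z.1‖ := by
    intro t θ θ' z hz
    have hz' := hG' z hz
    have hb := hbox θ θ.2 _ hz'.1
    have hb' := hbox θ' θ'.2 _ hz'.1
    rw [hl t θ z hz, hl t θ' z hz, ← Real.dist_eq]
    refine ((hLn _ hz'.2).dist_le_mul _ (hZ t _ hz'.1 _ hb) _ (hZ t _ hz'.1 _ hb')).trans ?_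
    rw [dist_eq_norm, mul_assoc]
    exact mul_le_mul_of_nonneg_left (hleast.1.2 t _ hz'.1 _ hb _ hb') Ln.2
  have hhc : ∀ Y ∈ 𝕐, Continuous fun θ : Θ => h θ Y := fun Y hY =>
    continuousOn_iff_continuous_domRestrict.1 (hcont Y hY)
  have hlc : ∀ t z, Continuous fun θ => l t θ z := fun t z => by
    by_cases hz : z ∈ G
    · refine continuous_iff_continuousAt.2 fun θ => tendsto_iff_norm_sub_tendsto_zero.2 ?_
      have hlim : Filter.Tendsto (fun θ' : Θ => Ln * L * ‖h θ' z.1 - h θ z.1‖) (nhds θ)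
          (nhds 0) := by
        have := (((hhc _ (hG' z hz).1).sub continuous_const).norm.const_mul
          (Ln * L)).tendsto (f := fun θ' : Θ => Ln * L * ‖h θ' z.1 - h θ z.1‖) θ
        simpa using this
      exact squeeze_zero (fun _ => norm_nonneg _) (fun θ' => hlLip t θ' θ z hz) hlim
    · simpa [l, HWnet.truncLoss_of_notMem hz] using continuous_const
  obtain ⟨A, hAm, hA, hAS⟩ := HWnet.exists_deviation_le_gaussian (κ := Fin M) D
    (Φ := fun (k : HWnet.PairIdx N) θ z => ω k * l k.1 θ z) (b := fun k => ω k * Bl)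
    (fun k θ => (hlm k.1 θ).const_mul _) (fun k z => (hlc k.1 z).const_mul _)
    (fun k θ z => by
      rw [abs_mul, abs_of_nonneg (hω k)]
      exact mul_le_mul_of_nonneg_left (hlb k.1 θ z) (hω k)) ⟨θstar, hθstar⟩ hδ hδ1
  have hpiG : ∀ᵐ S ∂(HWnet.sampleLaw N D), S ∈ Set.univ.pi fun _ : HWnet.PairIdx N => G := by
    have : ∀ᵐ S ∂(HWnet.sampleLaw N D), ∀ k, S k ∈ G := ae_all_iff.2 fun k =>
      Measure.tendsto_eval_ae_ae.eventually hG
    filter_upwards [this] with S hS k _ using hS k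
  refine ⟨A ∩ Set.univ.pi fun _ => G,
    hAm.inter (MeasurableSet.univ_pi fun _ => hGm), ?_, fun S hS => ?_⟩
  · refine hA.trans (measure_mono_ae ?_)
    filter_upwards [hpiG] with S hS hSA using ⟨hSA, hS⟩
  obtain ⟨hSA, hSG⟩ := hS
  have hSG' : ∀ k, S k ∈ G := fun k => hSG k (Set.mem_univ k)
  obtain ⟨hmem, hmin⟩ := hθhat S fun k => hG' _ (hSG' k)
  -- both risks are sums over the training pairs
  have hexp : ∀ θ : Θ, HWnet.expRisk D lam R loss (h θ) = ∑ k, ∫ z, ω k * l k.1 θ z ∂D := by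
    intro θ
    rw [Fintype.sum_sigma, HWnet.expRisk, Finset.mul_sum]
    refine Finset.sum_congr rfl fun t _ => ?_
    have : ∫ z, loss (HWnet.denoise (lam t) (R t) (h θ z.1) z.1) z.2 ∂D = ∫ z, l t θ z ∂D := by
      refine integral_congr_ae ?_
      filter_upwards [hG] with z hz using (hl t θ z hz).symm
    rw [this]
    simp only [ω, integral_const_mul, Finset.sum_const, Finset.card_univ, Fintype.card_fin,
      nsmul_eq_mul]
    have := (hNpos t).ne'
    field_simp
  have hemp : ∀ θ : Θ, HWnet.empRisk N lam R loss S (h θ) = ∑ k, ω k * l k.1 θ (S k) := by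
    intro θ
    rw [Fintype.sum_sigma, HWnet.empRisk, Finset.mul_sum]
    refine Finset.sum_congr rfl fun t _ => ?_
    rw [Finset.mul_sum, Finset.mul_sum]
    refine Finset.sum_congr rfl fun i _ => ?_
    rw [hl t θ _ (hSG' ⟨t, i⟩), mul_assoc]
  -- the networks, scaled such that their increments dominate those of the weighted losses
  let v : HWnet.PairIdx N → Θ → Fin M → ℝ := fun k θ m => ω k * (Ln * L) * h θ (S k).1 m
  have hvc : ∀ k m, Continuous fun θ => v k θ m := fun k m => by
    have h1 : Continuous fun θ : Θ => h θ (S k).1 m :=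
      (EuclideanSpace.proj (𝕜 := ℝ) m).continuous.comp (hhc _ (hG' _ (hSG' k)).1)
    exact h1.const_mul (ω k * (Ln * L))
  have hmain := hAS S hSA v ((∑ k, ω k) * (Ln * L) * BH)
    (fun k m => hvc k m)
    (fun k θ m => by
      have hb := hbox θ θ.2 _ (hG' _ (hSG' k)).1 m
      have h1 : |h θ (S k).1 m| ≤ BH := by
        rw [abs_of_nonneg (hε.le.trans hb.1)]
        exact hb.2
      have h2 : ω k ≤ ∑ k, ω k := Finset.single_le_sum (fun k _ => hω k) (Finset.mem_univ k)
      simp only [v]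
      rw [abs_mul, abs_of_nonneg (mul_nonneg (hω k) hLL)]
      have := hω k
      gcongr)
    (fun k θ θ' => by
      have h3 : (0 : ℝ) ≤ ω k * (Ln * L) := mul_nonneg (hω k) hLL
      have h4 : ∑ m, (v k θ m - v k θ' m) ^ 2
          = (ω k * (Ln * L) * ‖h θ (S k).1 - h θ' (S k).1‖) ^ 2 := by
        rw [mul_pow, HWnet.norm_sq_eq_sum, Finset.mul_sum]
        refine Finset.sum_congr rfl fun m _ => ?_
        simp only [v, PiLp.sub_apply]
        ring
      rw [h4, Real.sqrt_sq (by positivity), ← mul_sub, abs_mul, abs_of_nonneg (hω k),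
        mul_assoc (ω k)]
      exact mul_le_mul_of_nonneg_left (hlLip k.1 θ θ' _ (hSG' k)) (hω k))
    ⟨θhat S, hmem⟩
  rw [Finset.sum_sub_distrib, Finset.sum_sub_distrib, ← hexp, ← hexp, ← hemp, ← hemp] at hmain
  have hle : HWnet.empRisk N lam R loss S (h (θhat S)) ≤ HWnet.empRisk N lam R loss S (h θstar) :=
    hmin hθstar
  have hgauss : ∫ g : HWnet.PairIdx N × Fin M → ℝ, (⨆ θ, ∑ k, ∑ m, g (k, m) * v k θ m)
      ∂(HWnet.gaussPi (HWnet.PairIdx N × Fin M)) = Ln * L * HWnet.gaussComplexity N Θ h S := by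
    rw [HWnet.gaussComplexity, ← integral_const_mul]
    congr 1
    ext g
    rw [Real.mul_iSup_of_nonneg hLL]
    refine iSup_congr fun θ => ?_
    simp only [v, ω]
    rw [Fintype.sum_sigma]
    simp only [Finset.mul_sum]
    refine Finset.sum_congr rfl fun t _ => Finset.sum_congr rfl fun i _ =>
      Finset.sum_congr rfl fun m _ => ?_
    ring
  have hsq : √(∑ k : HWnet.PairIdx N, (ω k * Bl) ^ 2) = Bl / T * √(∑ t, 1 / (N t : ℝ)) := by
    have : ∑ k : HWnet.PairIdx N, (ω k * Bl) ^ 2 = (Bl / T) ^ 2 * ∑ t, 1 / (N t : ℝ) := by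
      rw [Fintype.sum_sigma, Finset.mul_sum]
      refine Finset.sum_congr rfl fun t _ => ?_
      simp only [ω, Finset.sum_const, Finset.card_univ, Fintype.card_fin, nsmul_eq_mul]
      have := (hNpos t).ne'
      field_simp
    rw [this, Real.sqrt_mul (sq_nonneg _), Real.sqrt_sq (by positivity)]
  have hlog : √(Real.log (1 / δ) / 2) ≤ √(Real.log (2 / δ) / 2) := by
    refine Real.sqrt_le_sqrt (div_le_div_of_nonneg_right (Real.log_le_log (by positivity) ?_)
      (by norm_num))
    gcongr
    norm_num
  rw [hgauss, hsq] at hmain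
  have hfin : 6 * (Bl / T * √(∑ t, 1 / (N t : ℝ))) * √(Real.log (1 / δ) / 2)
      ≤ 6 * (Bl / T * √(∑ t, 1 / (N t : ℝ))) * √(Real.log (2 / δ) / 2) :=
    mul_le_mul_of_nonneg_left hlog (by positivity)
  have e1 : 6 * (Bl / T * √(∑ t, 1 / (N t : ℝ))) * √(Real.log (2 / δ) / 2)
      = 6 * Bl / T * √(∑ t, 1 / (N t : ℝ)) * √(Real.log (2 / δ) / 2) := by ring
  have e2 : 6 * (Ln * L * HWnet.gaussComplexity N Θ h S)
      = 6 * Ln * L * HWnet.gaussComplexity N Θ h S := by ring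
  rw [e1] at hfin
  rw [e2] at hmain
  linarith
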